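/- **Proposition 1.** *Model.* Consider $S$ base stations (BSs) at positions $\mathbf q_1,\dots,\mathbf q_S\in\mathbb R^2$, each with a uniform linear array of $N$ antennas with steering vector $\mathbf a(\theta)=[1,e^{-j\pi\sin\theta},\dots,e^{-j(N-1)\pi\sin\theta}]^T$; $K$ communication users; and a point target at $\mathbf p=[p_1,p_2]^T\in\mathbb R^2$, different from all $\mathbf q_{s'}$. Let BS $s$ be the receiving BS, and let all BSs $s'\neq s$ transmit $$\mathbf x_{s'}(t)=\sum_{k=1}^K a_{s',k}\mathbf w_{s',k}\,s_{s',k}(t)+\mathbf s_{s',0}(t),\qquad a_{s',k}\in\{0,1\},\ \mathbf w_{s',k}\in\mathbb C^N .$$ The signals $s_{s',k}$, $\mathbf s_{s',0}$ (random or deterministic functions of time, measured in slots) are known to the receiver, and their distribution does not depend on the unknowns. Let $\theta_{s'}(\mathbf p)$ be the angle of the target seen from BS $s'$ relative to the boresight of its array, $\tau_{s,s'}(\mathbf p)=(\|\mathbf p-\mathbf q_{s'}\|+\|\mathbf p-\mathbf q_s\|)/c$ the delay in slots ($c>0$), $\mathbf G_{s,s'}=\mathbf a(\theta_s)\mathbf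 a(\theta_{s'})^H$, and $\mathbf X_{s,s'}=[\mathbf x_{s'}(1-\tau_{s,s'}),\dots,\mathbf x_{s'}(L-\tau_{s,s'})]$. Given the transmitted signals, the vectorized echo is $$\tilde{\mathbf y}=\sum_{s'\ne s}\alpha_{s,s'}\,\mathrm{vec}(\mathbf G_{s,s'}\mathbf X_{s,s'})+\tilde{\mathbf z},\qquad \tilde{\mathbf z}\sim\mathcal{CN}(\mathbf 0,\sigma^2\mathbf I_{NL}),\ \sigma>0 .$$ The unknowns are $\boldsymbol\xi=[\mathbf p^T,\boldsymbol\alpha^T]^T$, where $\boldsymbol\alpha\in\mathbb R^{2(S-1)}$ lists the real parts and then the imaginary parts of the $\alpha_{s,s'}$, $s'\neq s$. Assume that at the instants $l-\tau_{s,s'}(\mathbf p)$, $1\le l\le L$, the signals are almost surely differentiable, with values and time derivatives of finite second moment. Let $$\mathbf F=\begin{bmatrix}\mathbf F_{\mathbf p\mathbf p}&\mathbf F_{\mathbf p\boldsymbol\alpha}\\ \mathbf F_{\mathbf p\boldsymbol\alpha}^T&\mathbf F_{\boldsymbol\alpha\boldsymbol\alpha}\end{bmatrix}$$ be the Fisher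 information matrix for $\boldsymbol\xi$ of the observation consisting of the transmitted signals and the echo, i.e. the matrix of second moments of the score (which is square integrable). Let $\mathrm{CRLB}^{(s)}(\mathbf p)$ be the trace of the $\mathbf p$-block of $\mathbf F^{-1}$. (a) If $\mathbf F$ is invertible, then so are $\mathbf F_{\boldsymbol\alpha\boldsymbol\alpha}$ and $\mathbf F_{\mathbf p\mathbf p}-\mathbf F_{\mathbf p\boldsymbol\alpha}\mathbf F_{\boldsymbol\alpha\boldsymbol\alpha}^{-1}\mathbf F_{\mathbf p\boldsymbol\alpha}^T$, and $$\mathrm{CRLB}^{(s)}(\mathbf p)=\mathrm{tr}\Big(\big(\mathbf F_{\mathbf p\mathbf p}-\mathbf F_{\mathbf p\boldsymbol\alpha}\mathbf F_{\boldsymbol\alpha\boldsymbol\alpha}^{-1}\mathbf F_{\mathbf p\boldsymbol\alpha}^T\big)^{-1}\Big).$$ Every estimator $\hat{\mathbf p}$ of the position that, given the transmitted signals, is unbiased for all parameters near $\boldsymbol\xi$ satisfies $\mathbb E\|\hat{\mathbf p}-\mathbf p\|^2\ge \mathrm{CRLB}^{(s)}(\mathbf p)$. (b) Write $\dot{(\cdot)}^{(i)}=\partial/\partial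 p_i$, and let $\mathbf R_{s'}=\frac1L\sum_{l=1}^L\mathbb E\,\mathbf s_{s',0}(l)\mathbf s_{s',0}(l)^H$. Suppose that the delayed signals obey the convention $\dot{\mathbf X}^{(i)}_{s,s'}=-\dot\tau^{(i)}_{s,s'}\mathbf X_{s,s'}$. Suppose also that at the instants $l-\tau_{s,s'}(\mathbf p)$, on average over the $L$ slots and the randomness, the communication signals have unit power and are mutually uncorrelated, they are uncorrelated with the sensing signals, the sensing signals of different BSs are uncorrelated, and $\mathbf s_{s',0}$ has covariance $\mathbf R_{s'}$. With $\mathbf Q_{s'}=\sum_k a_{s',k}\mathbf w_{s',k}\mathbf w_{s',k}^H+\mathbf R_{s'}$ and $$\tilde{\mathbf G}^{(i)}_{s,s'}=\dot{\mathbf a}^{(i)}(\theta_s)\mathbf a(\theta_{s'})^H+\mathbf a(\theta_s)\dot{\mathbf a}^{(i)}(\theta_{s'})^H-\dot\tau^{(i)}_{s,s'}\mathbf G_{s,s'},$$ the blocks of $\mathbf F$ are $$[\mathbf F_{\mathbf p\mathbf p}]_{ij}=\tfrac{2L}{\sigma^2}\Re\,\mathrm{tr}\Big(\sum_{s'\ne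 s}|\alpha_{s,s'}|^2\tilde{\mathbf G}^{(j)}_{s,s'}\mathbf Q_{s'}[\tilde{\mathbf G}^{(i)}_{s,s'}]^H\Big),\quad \mathbf F_{\mathbf p\boldsymbol\alpha}=\tfrac{2L}{\sigma^2}\Re\{[1,j]\otimes\mathbf D\},\quad \mathbf F_{\boldsymbol\alpha\boldsymbol\alpha}=\tfrac{2L}{\sigma^2}\mathbf I_2\otimes\mathbf E,$$ where $\mathbf D\in\mathbb C^{2\times(S-1)}$ has entries $\mathbf D_{i,s'}=\alpha_{s,s'}^*\mathrm{tr}(\mathbf G_{s,s'}\mathbf Q_{s'}[\tilde{\mathbf G}^{(i)}_{s,s'}]^H)$, and $\mathbf E$ is diagonal with entries $\mathrm{tr}(\mathbf G_{s,s'}\mathbf Q_{s'}\mathbf G_{s,s'}^H)$, $s'\neq s$. If $\mathbf F$ is invertible, the formula in (a) thus holds with these blocks. -/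

import Mathlib

open MeasureTheory Matrix
open scoped Topology

/-- Points of the plane. -/
abbrev Plane : Type := EuclideanSpace ℝ (Fin 2)

/-- The `i`-th partial derivative of a function on the plane. -/
noncomputable def partialDeriv {E : Type*} [NormedAddCommGroup E] [NormedSpace ℝ E]
    (f : Plane → E) (p : Plane) (i : Fin 2) : E :=
  lineDeriv ℝ f p (EuclideanSpace.single i (1 : ℝ))

/-- Steering vector of a uniform linear array with `N` antennas (half-wavelength spacing):
`a(θ) = [1, e^{-jπ sin θ}, …, e^{-j(N-1)π sin θ}]ᵀ`. -/
noncomputable def steering (N : ℕ) (θ : ℝ) : Fin N → ℂ :=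
  fun n => Complex.exp (-Complex.I * (n : ℂ) * (Real.pi : ℂ) * (Real.sin θ : ℂ))

/-- A network of `S` base stations with `N` antennas each, `K` communication users and a
sensing interval of `L` time slots. The transmitted waveforms are functions of (real) time, in
units of time slots, and of the random outcome `ω : Ω`; nonrandom waveforms are those that do
not depend on `ω`. -/
structure IsacNetwork (S K N L : ℕ) (Ω : Type*) where
  /-- positions of the base stations -/
  pos : Fin S → Plane
  /-- boresight directions of the arrays, as angles from the first coordinate axis -/
  boresight : Fin S → ℝ
  /-- propagation speed, in units of length per time slot -/
  speed : ℝ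
  speed_pos : 0 < speed
  /-- standard deviations of the receiver noise -/
  noise : Fin S → ℝ
  noise_pos : ∀ s, 0 < noise s
  /-- `assoc s k`: user `k` is served by base station `s` -/
  assoc : Fin S → Fin K → Bool
  /-- beamforming vectors -/
  beam : Fin S → Fin K → Fin N → ℂ
  /-- communication signals -/
  sym : Fin S → Fin K → ℝ → Ω → ℂ
  /-- dedicated sensing signals -/
  sens : Fin S → ℝ → Ω → Fin N → ℂ

namespace IsacNetwork

variable {S K N L : ℕ} {Ω : Type*} (M : IsacNetwork S K N L Ω)

/-- The transmitting base stations when `s` is the receiving one. -/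
abbrev Tx (s : Fin S) : Type := {s' : Fin S // s' ≠ s}

/-- Index set of the real unknowns `[p₁, p₂, Re α, Im α]`. -/
abbrev Idx (s : Fin S) : Type := Fin 2 ⊕ (Tx s ⊕ Tx s)

/-- The real parameter vectors. -/
abbrev Param (s : Fin S) : Type := Idx s → ℝ

/-- Target position encoded in a parameter vector. -/
def target {s : Fin S} (ξ : Param s) : Plane := WithLp.toLp 2 fun i => ξ (Sum.inl i)

/-- Complex gain of the link from `s'` via the target to `s`. -/
noncomputable def gain {s : Fin S} (ξ : Param s) (s' : Tx s) : ℂ :=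
  ⟨ξ (Sum.inr (Sum.inl s')), ξ (Sum.inr (Sum.inr s'))⟩

/-- The vectorized observations. -/
abbrev Obs (N L : ℕ) : Type := Fin L × Fin N → ℂ

/-! ### Geometry -/

/-- Angle of the target at `p` seen from base station `s`, relative to the boresight. -/
noncomputable def angle (s : Fin S) (p : Plane) : ℝ :=
  Complex.arg ((⟨p 0 - M.pos s 0, p 1 - M.pos s 1⟩ : ℂ) *
    Complex.exp (-Complex.I * (M.boresight s : ℂ)))

/-- Delay (in time slots) from `s'` to the target at `p` and on to `s`. -/
noncomputable def delay (s s' : Fin S) (p : Plane) : ℝ :=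
  (‖p - M.pos s'‖ + ‖p - M.pos s‖) / M.speed

/-- The sampling instant `l - τ_{s,s'}(p)`, `l = 1, …, L`. -/
noncomputable def instant (s s' : Fin S) (p : Plane) (l : Fin L) : ℝ :=
  ((l : ℝ) + 1) - M.delay s s' p

/-- Target response matrix `G_{s,s'} = a(θ_{r,s}) a(θ_{t,s'})ᴴ`. -/
noncomputable def response (s s' : Fin S) (p : Plane) : Matrix (Fin N) (Fin N) ℂ :=
  vecMulVec (steering N (M.angle s p)) (star (steering N (M.angle s' p)))

/-! ### Transmitted signals -/

/-- Base station selection variable `b_{s'}` when `s` is the receiving base station. -/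
def select (s s' : Fin S) : ℂ := if s' = s then 0 else 1

/-- Waveform `x_{s'}(t)` transmitted by `s'` when `s` is the receiving base station. -/
noncomputable def transmit (s s' : Fin S) (ω : Ω) (t : ℝ) : Fin N → ℂ :=
  (∑ k, ((if M.assoc s' k then 1 else 0 : ℂ) * M.sym s' k t ω) • M.beam s' k) +
    select s s' • M.sens s' t ω

/-- `X_{s,s'} = [x_{s'}[1 - τ_{s,s'}], …, x_{s'}[L - τ_{s,s'}]]`. -/
noncomputable def delayed (s s' : Fin S) (ω : Ω) (p : Plane) : Matrix (Fin N) (Fin L) ℂ :=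
  Matrix.of fun n l => M.transmit s s' ω (M.instant s s' p l) n

/-! ### The stacked Gaussian echo model -/

/-- Noise-free vectorized echo `∑_{s' ≠ s} α_{s,s'} vec(G_{s,s'} X_{s,s'})`. -/
noncomputable def meanEcho (s : Fin S) (ξ : Param s) (ω : Ω) : Obs N L :=
  ∑ s' : Tx s, gain ξ s' • Matrix.vec (M.response s s' (target ξ) * M.delayed s s' ω (target ξ))

/-- Density of the echo given the transmitted signals: circularly symmetric complex Gaussian
with mean `meanEcho` and covariance `σ² I_{NL}`. -/
noncomputable def density (s : Fin S) (ξ : Param s) (ω : Ω) (y : Obs N L) : ℝ :=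
  ((Real.pi * M.noise s ^ 2) ^ (N * L))⁻¹ *
    Real.exp (-(∑ m, ‖y m - M.meanEcho s ξ ω m‖ ^ 2) / M.noise s ^ 2)

/-- Law of the echo given the transmitted signals. -/
noncomputable def condLaw (s : Fin S) (ξ : Param s) (ω : Ω) : Measure (Obs N L) :=
  volume.withDensity fun y => ENNReal.ofReal (M.density s ξ ω y)

/-- Log-likelihood of the observation `(ω, y)`: the transmitted signals are known to the
receiver and their distribution does not depend on the unknown parameters. -/
noncomputable def logLik (s : Fin S) (z : Ω × Obs N L) (ξ : Param s) : ℝ :=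
  Real.log (M.density s ξ z.1 z.2)

/-- Score: partial derivative of the log-likelihood in the `i`-th unknown. -/
noncomputable def score (s : Fin S) (ξ : Param s) (i : Idx s) (z : Ω × Obs N L) : ℝ :=
  lineDeriv ℝ (M.logLik s z) ξ (Pi.single i (1 : ℝ))

variable [MeasurableSpace Ω] (P : Measure Ω)

/-- Joint law of the (known) transmitted signals and the echo. -/
noncomputable def law (s : Fin S) (ξ : Param s) : Measure (Ω × Obs N L) :=
  (P.prod volume).withDensity fun z => ENNReal.ofReal (M.density s ξ z.1 z.2)

/-- Fisher information matrix. -/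
noncomputable def fisher (s : Fin S) (ξ : Param s) : Matrix (Idx s) (Idx s) ℝ :=
  Matrix.of fun i j => ∫ z, M.score s ξ i z * M.score s ξ j z ∂(M.law P s ξ)

/-- Cramér–Rao lower bound for the position: trace of the position block of the inverse Fisher
information matrix of all the unknowns. -/
noncomputable def crlb (s : Fin S) (ξ : Param s) : ℝ :=
  ((M.fisher P s ξ)⁻¹.toBlocks₁₁).trace

/-- `T` is an estimator of the target position which, given the transmitted signals, is
unbiased near the parameter vector `ξ`. -/
def IsUnbiased (s : Fin S) (ξ : Param s) (T : Ω × Obs N L → Plane) : Prop :=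
  Measurable T ∧ ∀ᵐ ω ∂P, ∀ᶠ η in 𝓝 ξ,
    Integrable (fun y => T (ω, y)) (M.condLaw s η ω) ∧
      ∫ y, T (ω, y) ∂(M.condLaw s η ω) = target η

/-- At the sampling instants the signals are almost surely differentiable in time, and their
values and time derivatives have finite second moments. -/
structure RegularSignals (s : Fin S) (p : Plane) : Prop where
  sym_diff : ∀ (s' : Tx s) (k : Fin K) (l : Fin L), ∀ᵐ ω ∂P,
    DifferentiableAt ℝ (fun t => M.sym s' k t ω) (M.instant s s' p l)
  sens_diff : ∀ (s' : Tx s) (n : Fin N) (l : Fin L), ∀ᵐ ω ∂P,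
    DifferentiableAt ℝ (fun t => M.sens s' t ω n) (M.instant s s' p l)
  sym_memLp : ∀ (s' : Tx s) (k : Fin K) (l : Fin L),
    MemLp (fun ω => M.sym s' k (M.instant s s' p l) ω) 2 P
  sens_memLp : ∀ (s' : Tx s) (n : Fin N) (l : Fin L),
    MemLp (fun ω => M.sens s' (M.instant s s' p l) ω n) 2 P
  sym_deriv_memLp : ∀ (s' : Tx s) (k : Fin K) (l : Fin L),
    MemLp (fun ω => deriv (fun t => M.sym s' k t ω) (M.instant s s' p l)) 2 P
  sens_deriv_memLp : ∀ (s' : Tx s) (n : Fin N) (l : Fin L),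
    MemLp (fun ω => deriv (fun t => M.sens s' t ω n) (M.instant s s' p l)) 2 P

/-! ### Second-order statistics and the explicit blocks -/

/-- Covariance of the sensing signal of `s'`: the (mean) sample covariance
`(1/L) ∑_l s_{s',0}[l] s_{s',0}[l]ᴴ`. -/
noncomputable def sensCov (s' : Fin S) : Matrix (Fin N) (Fin N) ℂ :=
  Matrix.of fun m n => (L : ℂ)⁻¹ * ∑ l : Fin L,
    ∫ ω, M.sens s' ((l : ℝ) + 1) ω m * star (M.sens s' ((l : ℝ) + 1) ω n) ∂P

/-- Transmit covariance `∑_k a_{s',k} w_{s',k} w_{s',k}ᴴ + R_{s'}` of a transmitting base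
station. -/
noncomputable def txCov (s' : Fin S) : Matrix (Fin N) (Fin N) ℂ :=
  (∑ k, (if M.assoc s' k then 1 else 0 : ℂ) • vecMulVec (M.beam s' k) (star (M.beam s' k))) +
    M.sensCov P s'

/-- Second-order statistics over the delayed window, averaged over the `L` slots and the
randomness: the communication signals have unit power and are mutually uncorrelated, they are
uncorrelated with the sensing signals, the sensing signals of distinct base stations are
uncorrelated, and the covariance of each is not affected by the delay. -/
structure SignalStatistics (s : Fin S) (p : Plane) : Prop where
  sym_sym : ∀ (s₁ s₂ : Tx s) (k₁ k₂ : Fin K),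
    (L : ℂ)⁻¹ * ∑ l : Fin L, ∫ ω, M.sym s₁ k₁ (M.instant s s₁ p l) ω *
        star (M.sym s₂ k₂ (M.instant s s₂ p l) ω) ∂P =
      if s₁ = s₂ ∧ k₁ = k₂ then 1 else 0
  sym_sens : ∀ (s₁ s₂ : Tx s) (k : Fin K) (n : Fin N),
    (L : ℂ)⁻¹ * ∑ l : Fin L, ∫ ω, M.sym s₁ k (M.instant s s₁ p l) ω *
        star (M.sens s₂ (M.instant s s₂ p l) ω n) ∂P = 0
  sens_sens : ∀ (s₁ s₂ : Tx s) (m n : Fin N),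
    (L : ℂ)⁻¹ * ∑ l : Fin L, ∫ ω, M.sens s₁ (M.instant s s₁ p l) ω m *
        star (M.sens s₂ (M.instant s s₂ p l) ω n) ∂P =
      if s₁ = s₂ then M.sensCov P s₁ m n else 0

/-- Derivative `τ̇^{(i)}_{s,s'}` of the delay in `p_i`. -/
noncomputable def delayDeriv (s s' : Fin S) (p : Plane) (i : Fin 2) : ℝ :=
  partialDeriv (M.delay s s') p i

/-- The convention `∂X_{s,s'}/∂p_i = -τ̇^{(i)}_{s,s'} X_{s,s'}` for the delayed signals. -/
def DelayConvention (s : Fin S) (p : Plane) : Prop :=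
  ∀ᵐ ω ∂P, ∀ (s' : Tx s) (i : Fin 2) (n : Fin N) (l : Fin L),
    partialDeriv (fun q => M.delayed s s' ω q n l) p i =
      -(M.delayDeriv s s' p i : ℂ) * M.delayed s s' ω p n l

/-- Derivative `ȧ^{(i)}(θ_s)` of the steering vector in `p_i`. -/
noncomputable def steeringDeriv (s : Fin S) (p : Plane) (i : Fin 2) : Fin N → ℂ :=
  partialDeriv (fun q => steering N (M.angle s q)) p i

/-- `Ġ^{(i)}_{s,s'} = ȧ^{(i)}(θ_{r,s}) a(θ_{t,s'})ᴴ + a(θ_{r,s}) ȧ^{(i)}(θ_{t,s'})ᴴ`. -/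
noncomputable def responseDeriv (s s' : Fin S) (p : Plane) (i : Fin 2) :
    Matrix (Fin N) (Fin N) ℂ :=
  vecMulVec (M.steeringDeriv s p i) (star (steering N (M.angle s' p))) +
    vecMulVec (steering N (M.angle s p)) (star (M.steeringDeriv s' p i))

/-- `G̃^{(i)}_{s,s'} = Ġ^{(i)}_{s,s'} - τ̇^{(i)}_{s,s'} G_{s,s'}`. -/
noncomputable def responseTilde (s s' : Fin S) (p : Plane) (i : Fin 2) :
    Matrix (Fin N) (Fin N) ℂ :=
  M.responseDeriv s s' p i - (M.delayDeriv s s' p i : ℂ) • M.response s s' p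

/-- The factor `2L/σ²`. -/
noncomputable def snrFactor (s : Fin S) : ℝ := 2 * (L : ℝ) / M.noise s ^ 2

/-- Explicit position block. -/
noncomputable def Fpp (s : Fin S) (ξ : Param s) : Matrix (Fin 2) (Fin 2) ℝ :=
  M.snrFactor s • Matrix.of fun i j =>
    (Matrix.trace (∑ s' : Tx s, ((‖gain ξ s'‖ ^ 2 : ℝ) : ℂ) •
      (M.responseTilde s s' (target ξ) j * M.txCov P s' *
        (M.responseTilde s s' (target ξ) i)ᴴ))).re

/-- The `2 × (S-1)` matrix `D`. -/
noncomputable def Dmat (s : Fin S) (ξ : Param s) : Matrix (Fin 2) (Tx s) ℂ :=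
  Matrix.of fun i s' => star (gain ξ s') *
    Matrix.trace (M.response s s' (target ξ) * M.txCov P s' *
      (M.responseTilde s s' (target ξ) i)ᴴ)

/-- Explicit mixed block `(2L/σ²) Re([1, j] ⊗ D)`. -/
noncomputable def Fpa (s : Fin S) (ξ : Param s) : Matrix (Fin 2) (Tx s ⊕ Tx s) ℝ :=
  M.snrFactor s • (Matrix.fromCols (M.Dmat P s ξ) (Complex.I • M.Dmat P s ξ)).map Complex.re

/-- The diagonal matrix `E` with entries `tr(G_{s,s'} Q_{s'} G_{s,s'}ᴴ)` (which are real). -/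
noncomputable def Emat (s : Fin S) (ξ : Param s) : Matrix (Tx s) (Tx s) ℝ :=
  Matrix.diagonal fun s' =>
    (Matrix.trace (M.response s s' (target ξ) * M.txCov P s' *
      (M.response s s' (target ξ))ᴴ)).re

/-- Explicit gain block `(2L/σ²) I₂ ⊗ E`. -/
noncomputable def Faa (s : Fin S) (ξ : Param s) : Matrix (Tx s ⊕ Tx s) (Tx s ⊕ Tx s) ℝ :=
  M.snrFactor s • Matrix.fromBlocks (M.Emat P s ξ) 0 0 (M.Emat P s ξ)

end IsacNetwork

/-! Given the transmitted signals, the echo is a complex Gaussian vector with mean `μ(ξ)` and fixed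
covariance `σ² I`, so the score is linear in the noise: `(2/σ²) Re⟨y - μ, ∂ᵢμ⟩` (`score_eq`).
Everything reduces to the first two moments of the Gaussian and to the derivatives of `μ`.

The analytic core is `hasDerivAt_integral_shiftRatio`: the expectation of a square integrable `f`
under a shifted Gaussian may be differentiated along a curve of shifts, and the derivative is the
covariance of `f` with the score. For `f` constant or linear it yields the moments of the noise,
hence `F i j = (2/σ²) E Re⟨∂ᵢμ, ∂ⱼμ⟩` (`RegularSignals.fisher_apply`). For `f` a coordinate of an
unbiased estimator it yields covariance `1` with the score of that coordinate and `0` with all the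
others (`integral_estimator_mul_score`). The random signals enter through a change of variables `(ω,
w) ↦ (ω, w + μ ω)`, under which the joint law becomes a product of signals and independent noise.

The Cramér–Rao bound is then Hilbert space geometry: projecting the estimation error onto the span
of the scores gives `inv_momentMatrix_apply_le`, and the two coordinates are added. The Schur
complement formula needs no assumption beyond invertibility of `F`, because a matrix of second
moments is positive semidefinite, so an invertible one is positive definite and so are its principal
blocks.

For the explicit blocks, the delay convention makes every `∂ᵢμ` a sum of `A X` with a deterministic
matrix `A` (`meanDeriv_eq_sum_coeffMatrix`), and the signal statistics say that the delayed signals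
of different stations are uncorrelated with covariance `Q` on average over the slots. Hence each
entry of `F` is `(2L/σ²) Re ∑ tr(Aⱼ Q Aᵢᴴ)` (`fisher_apply_eq_trace`), and the blocks are read off
from it. -/

/-! ### The circularly symmetric complex Gaussian measure -/

section ComplexGaussian

variable {ι : Type*} [Fintype ι]

/-- Density of the centred circularly symmetric complex Gaussian vector with covariance
`σ² I`. -/
noncomputable def gaussPdf (σ : ℝ) (w : ι → ℂ) : ℝ :=
  ((Real.pi * σ ^ 2) ^ Fintype.card ι)⁻¹ * Real.exp (-(∑ m, ‖w m‖ ^ 2) / σ ^ 2)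

/-- The centred circularly symmetric complex Gaussian measure with covariance `σ² I`. -/
noncomputable def cgauss (ι : Type*) [Fintype ι] (σ : ℝ) : Measure (ι → ℂ) :=
  volume.withDensity fun w => ENNReal.ofReal (gaussPdf σ w)

/-- The real inner product `Re ⟨u, v⟩` on `ℂ^ι`. -/
noncomputable def reInner (u v : ι → ℂ) : ℝ := ∑ m, (star (u m) * v m).re

/-- Likelihood ratio of the Gaussian measure shifted by `δ` with respect to the centred one. -/
noncomputable def shiftRatio (σ : ℝ) (δ w : ι → ℂ) : ℝ :=
  Real.exp ((2 * reInner w δ - ∑ m, ‖δ m‖ ^ 2) / σ ^ 2)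

lemma gaussPdf_nonneg (σ : ℝ) (w : ι → ℂ) : 0 ≤ gaussPdf σ w := by
  unfold gaussPdf; positivity

lemma continuous_gaussPdf (σ : ℝ) : Continuous (gaussPdf σ : (ι → ℂ) → ℝ) := by
  unfold gaussPdf; fun_prop

lemma continuous_reInner_left (v : ι → ℂ) : Continuous fun w : ι → ℂ => reInner w v := by
  unfold reInner
  exact continuous_finsetSum _ fun m _ => Complex.continuous_re.comp
    (((continuous_apply m).star).mul continuous_const)

lemma continuous_shiftRatio (σ : ℝ) (δ : ι → ℂ) : Continuous (shiftRatio σ δ) := by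
  have := continuous_reInner_left δ
  unfold shiftRatio
  fun_prop

lemma reInner_comm (u v : ι → ℂ) : reInner u v = reInner v u := by
  unfold reInner
  refine Finset.sum_congr rfl fun m _ => ?_
  simp; ring

lemma reInner_smul_right (u v : ι → ℂ) (t : ℝ) : reInner u (t • v) = t * reInner u v := by
  unfold reInner
  rw [Finset.mul_sum]
  refine Finset.sum_congr rfl fun m _ => ?_
  simp; ring

lemma reInner_add_right (u v w : ι → ℂ) : reInner u (v + w) = reInner u v + reInner u w := by
  unfold reInner
  rw [← Finset.sum_add_distrib]
  refine Finset.sum_congr rfl fun m _ => ?_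
  simp; ring

lemma sum_norm_sq_eq_reInner (u : ι → ℂ) : ∑ m, ‖u m‖ ^ 2 = reInner u u := by
  unfold reInner
  refine Finset.sum_congr rfl fun m _ => ?_
  rw [← Complex.normSq_eq_norm_sq, Complex.normSq_apply]
  simp

lemma abs_reInner_le (u v : ι → ℂ) : |reInner u v| ≤ Fintype.card ι * (‖u‖ * ‖v‖) := by
  unfold reInner
  refine (Finset.abs_sum_le_sum_abs _ _).trans ?_
  have : ∀ m ∈ (Finset.univ : Finset ι), |(star (u m) * v m).re| ≤ ‖u‖ * ‖v‖ := fun m _ => by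
    refine (Complex.abs_re_le_norm _).trans ?_
    rw [norm_mul, norm_star]
    exact mul_le_mul (norm_le_pi_norm u m) (norm_le_pi_norm v m) (norm_nonneg _) (norm_nonneg _)
  refine (Finset.sum_le_sum this).trans ?_
  simp

/-- `reInner u` as a continuous real linear map. -/
noncomputable def reInnerCLM (u : ι → ℂ) : (ι → ℂ) →L[ℝ] ℝ :=
  LinearMap.mkContinuous
    { toFun := reInner u
      map_add' := reInner_add_right u
      map_smul' := fun t v => reInner_smul_right u v t }
    (Fintype.card ι * ‖u‖) fun v => by
      have := abs_reInner_le u v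
      rw [← mul_assoc] at this
      exact this

lemma integral_exp_neg_mul_norm_sq_complex {b : ℝ} (hb : 0 < b) :
    ∫ z : ℂ, Real.exp (-b * ‖z‖ ^ 2) = Real.pi / b := by
  rw [GaussianFourier.integral_rexp_neg_mul_sq_norm hb]
  simp

lemma exp_neg_sum_norm_sq (b : ℝ) (w : ι → ℂ) :
    Real.exp (-b * ∑ m, ‖w m‖ ^ 2) = ∏ m, Real.exp (-b * ‖w m‖ ^ 2) := by
  rw [Finset.mul_sum, Real.exp_sum]

lemma integral_exp_neg_mul_sum_norm_sq {b : ℝ} (hb : 0 < b) :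
    ∫ w : ι → ℂ, Real.exp (-b * ∑ m, ‖w m‖ ^ 2) = (Real.pi / b) ^ Fintype.card ι := by
  simp_rw [exp_neg_sum_norm_sq]
  rw [integral_fintype_prod_volume_eq_prod (fun _ (z : ℂ) => Real.exp (-b * ‖z‖ ^ 2))]
  rw [integral_exp_neg_mul_norm_sq_complex hb, Finset.prod_const, Finset.card_univ]

lemma integrable_exp_neg_mul_sum_norm_sq {b : ℝ} (hb : 0 < b) :
    Integrable fun w : ι → ℂ => Real.exp (-b * ∑ m, ‖w m‖ ^ 2) := by
  -- The Bochner integral of a nonintegrable function is `0`, so the nonzero value just computed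
  -- proves integrability.
  refine Integrable.of_integral_ne_zero ?_
  rw [integral_exp_neg_mul_sum_norm_sq hb]
  have := Real.pi_pos
  positivity

lemma isProbabilityMeasure_cgauss {σ : ℝ} (hσ : 0 < σ) : IsProbabilityMeasure (cgauss ι σ) := by
  have hb : 0 < (σ ^ 2)⁻¹ := by positivity
  have hintegrable : Integrable fun w : ι → ℂ => gaussPdf σ w := by
    refine ((integrable_exp_neg_mul_sum_norm_sq hb).const_mul
      ((Real.pi * σ ^ 2) ^ Fintype.card ι)⁻¹).congr (ae_of_all _ fun w => ?_)
    simp only [gaussPdf]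
    congr 2
    ring
  refine ⟨?_⟩
  rw [cgauss, withDensity_apply _ MeasurableSet.univ, Measure.restrict_univ,
    ← ofReal_integral_eq_lintegral_ofReal hintegrable (ae_of_all _ (gaussPdf_nonneg σ))]
  have : ∫ w : ι → ℂ, gaussPdf σ w = 1 := by
    have h := integral_exp_neg_mul_sum_norm_sq (ι := ι) hb
    simp only [gaussPdf]
    rw [integral_const_mul]
    have e : ∀ w : ι → ℂ, -(∑ m, ‖w m‖ ^ 2) / σ ^ 2 = -(σ ^ 2)⁻¹ * ∑ m, ‖w m‖ ^ 2 :=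
      fun w => by ring
    simp_rw [e]
    rw [h, div_inv_eq_mul]
    exact inv_mul_cancel₀ (by have := Real.pi_pos; positivity)
  rw [this, ENNReal.ofReal_one]

lemma integrable_cgauss_iff {σ : ℝ} {f : (ι → ℂ) → ℝ} :
    Integrable f (cgauss ι σ) ↔ Integrable fun w => gaussPdf σ w * f w := by
  rw [cgauss, integrable_withDensity_iff_integrable_smul'
    (continuous_gaussPdf σ).measurable.ennreal_ofReal (ae_of_all _ fun w => ENNReal.ofReal_lt_top)]
  simp only [ENNReal.toReal_ofReal (gaussPdf_nonneg _ _), smul_eq_mul]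

/-- The norm of `ι → ℂ` is the sup norm, whereas the Gaussian exponent contains the Euclidean one.
-/
lemma norm_sq_le_sum_norm_sq (w : ι → ℂ) : ‖w‖ ^ 2 ≤ ∑ m, ‖w m‖ ^ 2 := by
  have h : ‖w‖ ≤ Real.sqrt (∑ m, ‖w m‖ ^ 2) := by
    refine (pi_norm_le_iff_of_nonneg (Real.sqrt_nonneg _)).2 fun m => ?_
    refine Real.le_sqrt_of_sq_le ?_
    exact Finset.single_le_sum (f := fun m => ‖w m‖ ^ 2) (fun _ _ => by positivity)
      (Finset.mem_univ m)
  calc ‖w‖ ^ 2 ≤ Real.sqrt (∑ m, ‖w m‖ ^ 2) ^ 2 := by gcongr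
    _ = _ := Real.sq_sqrt (Finset.sum_nonneg fun _ _ => by positivity)

/-- Half of the Gaussian exponent absorbs the linear one: `(aσ - ‖w‖/σ)² ≥ 0` gives `a‖w‖ ≤ a²σ²/2 +
‖w‖²/(2σ²)`. These exponential moments serve as dominating functions below. -/
lemma integrable_exp_mul_norm_cgauss {σ : ℝ} (hσ : 0 < σ) (a : ℝ) :
    Integrable (fun w : ι → ℂ => Real.exp (a * ‖w‖)) (cgauss ι σ) := by
  rw [integrable_cgauss_iff]
  have hb : 0 < (2 * σ ^ 2)⁻¹ := by positivity
  refine ((integrable_exp_neg_mul_sum_norm_sq hb).const_mul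
    (((Real.pi * σ ^ 2) ^ Fintype.card ι)⁻¹ * Real.exp (a ^ 2 * σ ^ 2 / 2))).mono'
    (by have := continuous_gaussPdf (ι := ι) σ; fun_prop) (ae_of_all _ fun w => ?_)
  rw [Real.norm_of_nonneg (mul_nonneg (gaussPdf_nonneg _ _) (Real.exp_nonneg _)), gaussPdf,
    mul_assoc, mul_assoc, ← Real.exp_add, ← Real.exp_add]
  refine mul_le_mul_of_nonneg_left (Real.exp_le_exp.2 ?_) (by have := Real.pi_pos; positivity)
  have h1 := norm_sq_le_sum_norm_sq w
  set q := ∑ m, ‖w m‖ ^ 2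
  have h2 : a * ‖w‖ ≤ a ^ 2 * σ ^ 2 / 2 + ‖w‖ ^ 2 / (2 * σ ^ 2) := by
    have h3 : 0 ≤ (a * σ - ‖w‖ / σ) ^ 2 := sq_nonneg _
    have h4 : (a * σ - ‖w‖ / σ) ^ 2 = a ^ 2 * σ ^ 2 - 2 * (a * ‖w‖) + ‖w‖ ^ 2 / σ ^ 2 := by
      field_simp
      ring
    have h5 : ‖w‖ ^ 2 / (2 * σ ^ 2) = ‖w‖ ^ 2 / σ ^ 2 / 2 := by field_simp
    linarith
  have h6 : ‖w‖ ^ 2 / (2 * σ ^ 2) ≤ q / (2 * σ ^ 2) := by gcongr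
  have h7 : -q / σ ^ 2 + q / (2 * σ ^ 2) = -(2 * σ ^ 2)⁻¹ * q := by field_simp; ring
  linarith

lemma memLp_exp_mul_norm_cgauss {σ : ℝ} (hσ : 0 < σ) (a : ℝ) :
    MemLp (fun w : ι → ℂ => Real.exp (a * ‖w‖)) 2 (cgauss ι σ) := by
  rw [memLp_two_iff_integrable_sq (by fun_prop)]
  refine (integrable_exp_mul_norm_cgauss hσ (2 * a)).congr (ae_of_all _ fun w => ?_)
  simp only [← Real.exp_nat_mul]
  congr 1
  push_cast
  ring

lemma memLp_reInner_cgauss {σ : ℝ} (hσ : 0 < σ) (v : ι → ℂ) :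
    MemLp (fun w : ι → ℂ => reInner w v) 2 (cgauss ι σ) := by
  refine ((memLp_exp_mul_norm_cgauss hσ 1).const_mul (Fintype.card ι * ‖v‖)).mono
    (continuous_reInner_left v).aestronglyMeasurable (ae_of_all _ fun w => ?_)
  rw [Real.norm_eq_abs, norm_mul, norm_mul, Real.norm_of_nonneg (Real.exp_nonneg _), one_mul]
  refine (abs_reInner_le w v).trans ?_
  have : ‖w‖ ≤ Real.exp ‖w‖ := (by linarith : ‖w‖ ≤ ‖w‖ + 1).trans (Real.add_one_le_exp _)
  simp only [norm_natCast, norm_norm]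
  calc _ = Fintype.card ι * ‖v‖ * ‖w‖ := by ring
    _ ≤ _ := by gcongr

/-- The Cameron–Martin formula, from expanding `‖w - δ‖²` in the Euclidean norm. -/
lemma gaussPdf_sub (σ : ℝ) (w δ : ι → ℂ) :
    gaussPdf σ (w - δ) = gaussPdf σ w * shiftRatio σ δ w := by
  unfold gaussPdf shiftRatio
  rw [mul_assoc, ← Real.exp_add]
  congr 2
  have : ∑ m, ‖(w - δ) m‖ ^ 2 = ∑ m, ‖w m‖ ^ 2 - 2 * reInner w δ + ∑ m, ‖δ m‖ ^ 2 := by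
    unfold reInner
    rw [Finset.mul_sum, ← Finset.sum_sub_distrib, ← Finset.sum_add_distrib]
    refine Finset.sum_congr rfl fun m _ => ?_
    simp only [← Complex.normSq_eq_norm_sq, Complex.normSq_apply]
    simp
    ring
  rw [this]
  ring

lemma withDensity_gaussPdf_sub (σ : ℝ) (c : ι → ℂ) :
    (volume.withDensity fun y => ENNReal.ofReal (gaussPdf σ (y - c))) =
      (cgauss ι σ).map (· + c) := by
  ext A hA
  have hc : Measurable fun w : ι → ℂ => w + c := measurable_id.add_const c
  have hm : MeasurableSet ((· + c) ⁻¹' A) := hc hA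
  rw [Measure.map_apply hc hA, cgauss, withDensity_apply _ hA,
    withDensity_apply _ hm, ← lintegral_indicator hA, ← lintegral_indicator hm,
    ← lintegral_add_right_eq_self _ c]
  refine lintegral_congr fun w => ?_
  simp only [Set.indicator, add_sub_cancel_right]
  rfl

lemma map_add_cgauss_eq_withDensity (σ : ℝ) (δ : ι → ℂ) :
    (cgauss ι σ).map (· + δ) =
      (cgauss ι σ).withDensity fun w => ENNReal.ofReal (shiftRatio σ δ w) := by
  rw [← withDensity_gaussPdf_sub, cgauss, ← withDensity_mul _
    (continuous_gaussPdf σ).measurable.ennreal_ofReal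
    (continuous_shiftRatio σ δ).measurable.ennreal_ofReal]
  congr 1
  ext w
  rw [Pi.mul_apply, gaussPdf_sub, ENNReal.ofReal_mul (gaussPdf_nonneg _ _)]

lemma integral_map_add_cgauss (σ : ℝ) (δ : ι → ℂ) (f : (ι → ℂ) → ℝ) :
    ∫ w, f w ∂(cgauss ι σ).map (· + δ) = ∫ w, f w * shiftRatio σ δ w ∂(cgauss ι σ) := by
  rw [map_add_cgauss_eq_withDensity, integral_withDensity_eq_integral_toReal_smul
    (continuous_shiftRatio σ δ).measurable.ennreal_ofReal
    (ae_of_all _ fun w => ENNReal.ofReal_lt_top)]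
  refine integral_congr_ae (ae_of_all _ fun w => ?_)
  simp only [shiftRatio, ENNReal.toReal_ofReal (Real.exp_nonneg _), smul_eq_mul]
  ring

/-- Both signs follow from `1 + x ≤ exp x`, taken at `-u` for `u ≥ 0` and at `u` for `u ≤ 0`. -/
lemma abs_exp_sub_one_le_mul_exp (u : ℝ) : |Real.exp u - 1| ≤ |u| * Real.exp |u| := by
  rcases le_total 0 u with h | h
  · rw [abs_of_nonneg h, abs_of_nonneg (by linarith [Real.one_le_exp h])]
    have h1 := Real.add_one_le_exp (-u)
    have h2 : Real.exp (-u) * Real.exp u = 1 := by rw [← Real.exp_add]; simp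
    nlinarith [Real.exp_pos u]
  · rw [abs_of_nonpos h, abs_of_nonpos (by linarith [Real.exp_le_one_iff.2 h])]
    have h1 := Real.add_one_le_exp u
    have h2 := Real.one_le_exp (neg_nonneg.2 h)
    nlinarith

/-- The exponent of the ratio is at most `A‖δ‖` with `A` affine in `‖w‖`, the quadratic term being
linear in size because `‖δ‖ ≤ 1`. The constant `4` is twice that of `A`: one factor `exp A` comes
from the exponential bound and one from `A ≤ exp A`. -/
lemma abs_shiftRatio_sub_one_le (σ : ℝ) (w δ : ι → ℂ) (hδ : ‖δ‖ ≤ 1) :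
    |shiftRatio σ δ w - 1| ≤
      Real.exp (4 * Fintype.card ι / σ ^ 2 * (‖w‖ + 1)) * ‖δ‖ := by
  set A : ℝ := 2 * Fintype.card ι / σ ^ 2 * (‖w‖ + 1) with hA
  have hA0 : 0 ≤ A := by positivity
  have hu : |(2 * reInner w δ - ∑ m, ‖δ m‖ ^ 2) / σ ^ 2| ≤ A * ‖δ‖ := by
    rw [abs_div, abs_of_nonneg (sq_nonneg σ), sum_norm_sq_eq_reInner]
    have h1 := abs_reInner_le w δ
    have h2 := abs_reInner_le δ δ
    have h3 : (Fintype.card ι : ℝ) * (‖δ‖ * ‖δ‖) ≤ 2 * Fintype.card ι * ‖δ‖ := by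
      have : ‖δ‖ * ‖δ‖ ≤ 2 * ‖δ‖ := by nlinarith [norm_nonneg δ]
      calc _ ≤ (Fintype.card ι : ℝ) * (2 * ‖δ‖) := by gcongr
        _ = _ := by ring
    have h4 : |2 * reInner w δ - reInner δ δ| ≤ 2 * Fintype.card ι * (‖w‖ + 1) * ‖δ‖ := by
      rw [abs_le] at h1 h2 ⊢
      constructor <;> nlinarith
    calc _ ≤ (2 * Fintype.card ι * (‖w‖ + 1) * ‖δ‖) / σ ^ 2 := by gcongr
      _ = _ := by rw [hA]; ring
  have hle : A * ‖δ‖ ≤ A := mul_le_of_le_one_right hA0 hδ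
  calc |shiftRatio σ δ w - 1| ≤ _ := abs_exp_sub_one_le_mul_exp _
    _ ≤ (A * ‖δ‖) * Real.exp A := by gcongr; exact hu.trans hle
    _ = (A * Real.exp A) * ‖δ‖ := by ring
    _ ≤ (Real.exp A * Real.exp A) * ‖δ‖ := by
      gcongr
      linarith [Real.add_one_le_exp A]
    _ = _ := by
      rw [← Real.exp_add, hA]
      congr 2
      ring

lemma integrable_mul_exp_norm_cgauss {σ : ℝ} (hσ : 0 < σ) {f : (ι → ℂ) → ℝ}
    (hf : MemLp f 2 (cgauss ι σ)) (a : ℝ) :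
    Integrable (fun w => f w * Real.exp (a * (‖w‖ + 1))) (cgauss ι σ) := by
  have h : MemLp (fun w : ι → ℂ => Real.exp a * Real.exp (a * ‖w‖)) 2 (cgauss ι σ) :=
    (memLp_exp_mul_norm_cgauss hσ a).const_mul _
  refine (hf.integrable_mul h).congr (ae_of_all _ fun w => ?_)
  simp only [Pi.mul_apply, ← Real.exp_add]
  ring_nf

/-- Differentiation of a Gaussian expectation along a curve of shifts. -/
lemma hasDerivAt_integral_shiftRatio {σ : ℝ} (hσ : 0 < σ) {f : (ι → ℂ) → ℝ}
    (hf : MemLp f 2 (cgauss ι σ)) {m : ℝ → ι → ℂ} {v : ι → ℂ} (hm0 : m 0 = 0)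
    (hm : HasDerivAt m v 0) :
    HasDerivAt (fun t => ∫ w, f w * shiftRatio σ (m t) w ∂(cgauss ι σ))
      (∫ w, f w * (2 / σ ^ 2 * reInner w v) ∂(cgauss ι σ)) 0 := by
  have := isProbabilityMeasure_cgauss (ι := ι) hσ
  -- Differentiability at `0` alone gives linear growth of the curve there.
  obtain ⟨C, hC0, hC⟩ : ∃ C : ℝ, 0 ≤ C ∧ ∀ᶠ t in 𝓝 (0 : ℝ), ‖m t‖ ≤ C * ‖t‖ := by
    obtain ⟨C, hC⟩ := hm.isBigO_sub.bound
    refine ⟨max C 0, le_max_right _ _, hC.mono fun t ht => ?_⟩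
    simp only [hm0, sub_zero] at ht
    exact ht.trans (by gcongr; exact le_max_left _ _)
  have hsmall : ∀ᶠ t in 𝓝 (0 : ℝ), ‖m t‖ ≤ 1 := by
    have : Filter.Tendsto (fun t => ‖m t‖) (𝓝 0) (𝓝 0) := by
      simpa [hm0] using hm.continuousAt.norm.tendsto
    exact (this.eventually (gt_mem_nhds one_pos)).mono fun t ht => ht.le
  set s : Set ℝ := {t | ‖m t‖ ≤ C * ‖t‖ ∧ ‖m t‖ ≤ 1}
  have hs : s ∈ 𝓝 (0 : ℝ) := hC.and hsmall
  set a : ℝ := 4 * Fintype.card ι / σ ^ 2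
  have hderiv : ∀ w : ι → ℂ, HasDerivAt (fun t => shiftRatio σ (m t) w)
      (2 / σ ^ 2 * reInner w v) 0 := fun w => by
    have h1 : HasDerivAt (fun t => reInner w (m t)) (reInner w v) 0 :=
      ((reInnerCLM w).hasFDerivAt.comp_hasDerivAt (0 : ℝ) hm)
    have h2 : HasDerivAt (fun t => ∑ i, ‖m t i‖ ^ 2) 0 0 := by
      have : ∀ i ∈ (Finset.univ : Finset ι), HasDerivAt (fun t => ‖m t i‖ ^ 2) 0 0 :=
        fun i _ => by
          have := (hasDerivAt_pi.1 hm i).norm_sq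
          simpa [hm0] using this
      simpa using HasDerivAt.fun_sum this
    have h3 := (((h1.const_mul 2).fun_sub h2).div_const (σ ^ 2)).exp
    have h4 : reInner w (0 : ι → ℂ) = 0 := map_zero (reInnerCLM w)
    refine h3.congr_deriv ?_
    simp [hm0, h4]
    ring
  -- The curve is differentiable only at `0`, so the version of differentiation under the integral
  -- is used that bounds increments from the base point only. The dominating function is integrable
  -- as a product of `f ∈ L²` with an exponential of the norm in `L²`.
  have hmain := hasFDerivAt_integral_of_dominated_loc_of_lip' (𝕜 := ℝ) (μ := cgauss ι σ)
    (F := fun t w => f w * shiftRatio σ (m t) w) (x₀ := (0 : ℝ)) (s := s)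
    (bound := fun w => C * |f w * Real.exp (a * (‖w‖ + 1))|)
    (F' := fun w => ContinuousLinearMap.toSpanSingletonCLE (𝕜 := ℝ)
      (f w * (2 / σ ^ 2 * reInner w v))) hs
    (fun t _ => hf.1.mul (continuous_shiftRatio σ (m t)).aestronglyMeasurable)
    ?_ ?_ ?_ ?_ ?_
  · have h := hmain.2.hasDerivAt
    refine h.congr_deriv ?_
    rw [ContinuousLinearMap.integral_apply hmain.1]
    simp
  · have : ∀ w : ι → ℂ, shiftRatio σ (m 0) w = 1 := fun w => by
      have h4 : reInner w (0 : ι → ℂ) = 0 := map_zero (reInnerCLM w)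
      simp [shiftRatio, hm0, h4]
    simp only [this, mul_one]
    exact hf.integrable (by norm_num)
  · exact (ContinuousLinearEquiv.continuous _).comp_aestronglyMeasurable
      (hf.1.mul (((continuous_reInner_left v).const_smul (2 / σ ^ 2)).aestronglyMeasurable))
  · refine ae_of_all _ fun w t ht => ?_
    have h0 : shiftRatio σ (m 0) w = 1 := by
      have h4 : reInner w (0 : ι → ℂ) = 0 := map_zero (reInnerCLM w)
      simp [shiftRatio, hm0, h4]
    rw [h0, ← mul_sub, norm_mul, Real.norm_eq_abs, Real.norm_eq_abs, sub_zero, abs_mul,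
      abs_of_nonneg (Real.exp_nonneg _)]
    calc |f w| * |shiftRatio σ (m t) w - 1|
        ≤ |f w| * (Real.exp (a * (‖w‖ + 1)) * ‖m t‖) := by
          gcongr
          exact abs_shiftRatio_sub_one_le σ w (m t) ht.2
      _ ≤ |f w| * (Real.exp (a * (‖w‖ + 1)) * (C * ‖t‖)) := by
          gcongr
          exact ht.1
      _ = _ := by ring
  · exact (integrable_mul_exp_norm_cgauss hσ hf a).abs.const_mul C
  · refine ae_of_all _ fun w => ?_
    exact ((hderiv w).const_mul (f w)).hasFDerivAt

/-- Take `f = 1` and the shifts `t • v` in the differentiation formula: the shifted measures all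
have mass one, so the derivative vanishes. -/
lemma integral_reInner_cgauss {σ : ℝ} (hσ : 0 < σ) (v : ι → ℂ) :
    ∫ w, reInner w v ∂(cgauss ι σ) = 0 := by
  have := isProbabilityMeasure_cgauss (ι := ι) hσ
  have hm : HasDerivAt (fun t : ℝ => t • v) v 0 := by
    simpa using (hasDerivAt_id (0 : ℝ)).smul_const v
  have h := hasDerivAt_integral_shiftRatio hσ (memLp_const (1 : ℝ)) (by simp) hm
  have hconst : (fun t : ℝ => ∫ w, (1 : ℝ) * shiftRatio σ (t • v) w ∂(cgauss ι σ)) =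
      fun _ => 1 := by
    funext t
    rw [← integral_map_add_cgauss, integral_map (by fun_prop) (by fun_prop)]
    simp
  rw [hconst] at h
  have h2 := h.unique (hasDerivAt_const (0 : ℝ) (1 : ℝ))
  simp only [one_mul] at h2
  rw [integral_const_mul] at h2
  exact (mul_eq_zero.1 h2).resolve_left (by positivity)

/-- Take `f w = reInner w u` in the differentiation formula. Its mean after the shift by `t • v` is
`t * reInner u v`, and comparing derivatives at `0` gives the covariance. -/
lemma integral_reInner_mul_reInner_cgauss {σ : ℝ} (hσ : 0 < σ) (u v : ι → ℂ) :
    ∫ w, reInner w u * reInner w v ∂(cgauss ι σ) = σ ^ 2 / 2 * reInner u v := by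
  have := isProbabilityMeasure_cgauss (ι := ι) hσ
  have hm : HasDerivAt (fun t : ℝ => t • v) v 0 := by
    simpa using (hasDerivAt_id (0 : ℝ)).smul_const v
  have hL := memLp_reInner_cgauss hσ u
  have h := hasDerivAt_integral_shiftRatio hσ hL (by simp) hm
  have hlin : (fun t : ℝ => ∫ w, reInner w u * shiftRatio σ (t • v) w ∂(cgauss ι σ)) =
      fun t => t * reInner u v := by
    funext t
    rw [← integral_map_add_cgauss, integral_map (by fun_prop)
      (continuous_reInner_left u).aestronglyMeasurable]
    have e : ∀ w : ι → ℂ, reInner (w + t • v) u = reInner w u + t * reInner u v := fun w => by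
      rw [reInner_comm, reInner_add_right, reInner_smul_right, reInner_comm u w]
    simp_rw [e]
    rw [integral_add (hL.integrable (by norm_num)) (integrable_const _),
      integral_reInner_cgauss hσ]
    simp
  rw [hlin] at h
  have h2 := h.unique (by simpa using (hasDerivAt_id (0 : ℝ)).mul_const (reInner u v))
  have h3 : ∀ w : ι → ℂ, reInner w u * (2 / σ ^ 2 * reInner w v) =
      2 / σ ^ 2 * (reInner w u * reInner w v) := fun w => by ring
  simp_rw [h3] at h2
  rw [integral_const_mul] at h2
  rw [← h2]
  field_simp

end ComplexGaussian

/-! ### Gaussian vectors with a random mean -/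

section RandomMean

variable {ι : Type*} [Fintype ι] {Ω : Type*} [MeasurableSpace Ω] {P : Measure Ω}

lemma measurable_shear {κ : Type*} {μ : Ω → κ → ℂ} (hμ : Measurable μ) :
    Measurable fun z : Ω × (κ → ℂ) => (z.1, z.2 + μ z.1) :=
  measurable_fst.prodMk (measurable_snd.add (hμ.comp measurable_fst))

/-- In each slice of fixed `ω` this is translation of the Gaussian. It turns the joint law of
signals and echo into a product of signals and noise. -/
lemma withDensity_gaussPdf_prod [SFinite P] (σ : ℝ) {μ : Ω → ι → ℂ} (hμ : Measurable μ) :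
    ((P.prod volume).withDensity fun z => ENNReal.ofReal (gaussPdf σ (z.2 - μ z.1))) =
      (P.prod (cgauss ι σ)).map fun z => (z.1, z.2 + μ z.1) := by
  have hmeas : Measurable fun z : Ω × (ι → ℂ) => ENNReal.ofReal (gaussPdf σ (z.2 - μ z.1)) :=
    ((continuous_gaussPdf σ).measurable.comp
      (measurable_snd.sub (hμ.comp measurable_fst))).ennreal_ofReal
  have : SFinite (cgauss ι σ) := by unfold cgauss; infer_instance
  ext A hA
  rw [Measure.map_apply (measurable_shear hμ) hA, withDensity_apply _ hA,
    ← lintegral_indicator hA, lintegral_prod _ ((hmeas.indicator hA).aemeasurable),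
    Measure.prod_apply (measurable_shear hμ hA)]
  refine lintegral_congr fun ω => ?_
  have h := DFunLike.congr_fun (withDensity_gaussPdf_sub (ι := ι) σ (μ ω)) (Prod.mk ω ⁻¹' A)
  have hA' : MeasurableSet (Prod.mk ω ⁻¹' A) := measurable_prodMk_left hA
  rw [withDensity_apply _ hA', ← lintegral_indicator hA',
    Measure.map_apply (measurable_id'.add_const _) hA'] at h
  exact h

lemma integrable_fun_mul_of_memLp {f g : Ω → ℝ} (hf : MemLp f 2 P) (hg : MemLp g 2 P) :
    Integrable (fun z => f z * g z) P :=
  hf.integrable_mul hg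

/-- Independence makes second moments multiply, so no higher moments are required of the factors. -/
lemma memLp_mul_prod {Ω' : Type*} [MeasurableSpace Ω'] {Q : Measure Ω'} [SFinite P] [SFinite Q]
    {f : Ω → ℝ} {g : Ω' → ℝ} (hf : MemLp f 2 P) (hg : MemLp g 2 Q) :
    MemLp (fun z : Ω × Ω' => f z.1 * g z.2) 2 (P.prod Q) := by
  refine (memLp_two_iff_integrable_sq (hf.1.comp_fst.mul hg.1.comp_snd)).2 ?_
  refine (hf.integrable_sq.mul_prod hg.integrable_sq).congr (ae_of_all _ fun z => ?_)
  simp only [Pi.mul_apply, mul_pow]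

lemma reInner_eq_sum (u v : ι → ℂ) :
    reInner u v = ∑ m, ((v m).re * (u m).re + (v m).im * (u m).im) := by
  unfold reInner
  refine Finset.sum_congr rfl fun m _ => ?_
  simp; ring

lemma memLp_re_cgauss {σ : ℝ} (hσ : 0 < σ) (m : ι) :
    MemLp (fun w : ι → ℂ => (w m).re) 2 (cgauss ι σ) := by
  classical
  refine (memLp_reInner_cgauss hσ (Pi.single m 1)).ae_eq (ae_of_all _ fun w => ?_)
  rw [reInner_eq_sum]
  simp only
  rw [Finset.sum_eq_single m]
  · simp
  · intro b _ hb
    simp [hb]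
  · simp

lemma memLp_im_cgauss {σ : ℝ} (hσ : 0 < σ) (m : ι) :
    MemLp (fun w : ι → ℂ => (w m).im) 2 (cgauss ι σ) := by
  classical
  refine (memLp_reInner_cgauss hσ (Pi.single m Complex.I)).ae_eq (ae_of_all _ fun w => ?_)
  rw [reInner_eq_sum]
  simp only
  rw [Finset.sum_eq_single m]
  · simp
  · intro b _ hb
    simp [hb]
  · simp

lemma memLp_reInner_prod [SFinite P] {σ : ℝ} (hσ : 0 < σ) {d : Ω → ι → ℂ}
    (hd : ∀ m, MemLp (fun ω => d ω m) 2 P) :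
    MemLp (fun z : Ω × (ι → ℂ) => reInner z.2 (d z.1)) 2 (P.prod (cgauss ι σ)) := by
  have := isProbabilityMeasure_cgauss (ι := ι) hσ
  simp_rw [reInner_eq_sum]
  exact memLp_finsetSum _ fun m _ =>
    (memLp_mul_prod (hd m).re (memLp_re_cgauss hσ m)).add
      (memLp_mul_prod (hd m).im (memLp_im_cgauss hσ m))

lemma integral_reInner_mul_reInner_prod [SFinite P] {σ : ℝ} (hσ : 0 < σ) {d e : Ω → ι → ℂ}
    (hd : ∀ m, MemLp (fun ω => d ω m) 2 P) (he : ∀ m, MemLp (fun ω => e ω m) 2 P) :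
    ∫ z, reInner z.2 (d z.1) * reInner z.2 (e z.1) ∂(P.prod (cgauss ι σ)) =
      σ ^ 2 / 2 * ∫ ω, reInner (d ω) (e ω) ∂P := by
  have := isProbabilityMeasure_cgauss (ι := ι) hσ
  rw [integral_prod _ (integrable_fun_mul_of_memLp (memLp_reInner_prod hσ hd)
      (memLp_reInner_prod hσ he)),
    ← integral_const_mul]
  exact integral_congr_ae (ae_of_all _ fun ω => 
    integral_reInner_mul_reInner_cgauss hσ (d ω) (e ω))

end RandomMean

/-! ### Information inequality -/

section Information

variable {κ : Type*} {Z : Type*} [MeasurableSpace Z] {Q : Measure Z}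

/-- Matrix of second moments of a family of functions. -/
noncomputable def momentMatrix (Q : Measure Z) (f : κ → Z → ℝ) : Matrix κ κ ℝ :=
  Matrix.of fun i j => ∫ z, f i z * f j z ∂Q

/-- The quadratic form is the second moment of the linear combination; this gives positivity and
also the norm of a projection in the information inequality. -/
lemma dotProduct_momentMatrix_mulVec [Fintype κ] {f : κ → Z → ℝ} (hf : ∀ i, MemLp (f i) 2 Q)
    (x : κ → ℝ) :
    x ⬝ᵥ momentMatrix Q f *ᵥ x = ∫ z, (∑ i, x i * f i z) ^ 2 ∂Q := by
  have hintegrable : ∀ i j, Integrable (fun z => x i * f i z * (x j * f j z)) Q := fun i j =>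
    ((hf i).const_mul (x i)).integrable_mul ((hf j).const_mul (x j))
  simp_rw [sq, Finset.sum_mul_sum]
  rw [integral_finsetSum _ fun i _ => integrable_finsetSum _ fun j _ => hintegrable i j]
  simp only [dotProduct, mulVec, momentMatrix, Matrix.of_apply]
  refine Finset.sum_congr rfl fun i _ => ?_
  rw [integral_finsetSum _ fun j _ => hintegrable i j, Finset.mul_sum]
  refine Finset.sum_congr rfl fun j _ => ?_
  rw [← integral_mul_const, ← integral_const_mul]
  refine integral_congr_ae (ae_of_all _ fun z => ?_)
  simp only
  ring

lemma momentMatrix_transpose (f : κ → Z → ℝ) : (momentMatrix Q f)ᵀ = momentMatrix Q f := by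
  ext i j
  simp only [momentMatrix, Matrix.transpose_apply, Matrix.of_apply]
  exact integral_congr_ae (ae_of_all _ fun z => mul_comm _ _)

lemma posSemidef_momentMatrix [Fintype κ] {f : κ → Z → ℝ} (hf : ∀ i, MemLp (f i) 2 Q) :
    (momentMatrix Q f).PosSemidef := by
  refine Matrix.PosSemidef.of_dotProduct_mulVec_nonneg ?_ fun x => ?_
  · rw [Matrix.IsHermitian, Matrix.conjTranspose_eq_transpose_of_trivial, momentMatrix_transpose]
  · rw [star_trivial, dotProduct_momentMatrix_mulVec hf]
    exact integral_nonneg fun z => sq_nonneg _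

/-- If `u` has inner product `1` with `f k` and is orthogonal to the other `f i`, then its second
moment is at least the `k`-th diagonal entry of the inverse matrix of second moments. -/
lemma inv_momentMatrix_apply_le [Fintype κ] [DecidableEq κ] {f : κ → Z → ℝ}
    (hf : ∀ i, MemLp (f i) 2 Q)
    (hdet : IsUnit (momentMatrix Q f).det) {u : Z → ℝ} (hu : MemLp u 2 Q) (k : κ)
    (huf : ∀ i, ∫ z, u z * f i z ∂Q = if i = k then 1 else 0) :
    (momentMatrix Q f)⁻¹ k k ≤ ∫ z, u z ^ 2 ∂Q := by
  set G := momentMatrix Q f with hG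
  -- The `k`-th column of `G⁻¹` holds the coefficients of the orthogonal projection of `u` onto the
  -- span of the `f i`. This projection has second moment `G⁻¹ k k`, and so has its inner product
  -- with `u`.
  set x : κ → ℝ := fun j => G⁻¹ j k with hx
  have hGx : G *ᵥ x = Pi.single k 1 := by
    have h : x = G⁻¹ *ᵥ Pi.single k 1 := by
      ext j
      simp [hx]
    rw [h, Matrix.mulVec_mulVec, Matrix.mul_nonsing_inv _ hdet, Matrix.one_mulVec]
  have hsum : MemLp (fun z => ∑ i, x i * f i z) 2 Q :=
    memLp_finsetSum _ fun i _ => (hf i).const_mul (x i)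
  have hcross : ∫ z, u z * ∑ i, x i * f i z ∂Q = x k := by
    simp_rw [Finset.mul_sum]
    rw [integral_finsetSum _ fun i _ =>
      integrable_fun_mul_of_memLp hu ((hf i).const_mul (x i))]
    have : ∀ i, ∫ z, u z * (x i * f i z) ∂Q = x i * if i = k then 1 else 0 := fun i => by
      rw [← huf i, ← integral_const_mul]
      refine integral_congr_ae (ae_of_all _ fun z => ?_)
      simp only
      ring
    simp [this]
  have hsq : ∫ z, (∑ i, x i * f i z) ^ 2 ∂Q = x k := by
    rw [← dotProduct_momentMatrix_mulVec hf, ← hG, hGx]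
    simp
  have hnn : 0 ≤ ∫ z, (u z - ∑ i, x i * f i z) ^ 2 ∂Q := integral_nonneg fun z => sq_nonneg _
  have hexp : ∫ z, (u z - ∑ i, x i * f i z) ^ 2 ∂Q =
      ∫ z, u z ^ 2 ∂Q - 2 * x k + x k := by
    have e : ∀ z, (u z - ∑ i, x i * f i z) ^ 2 =
        u z ^ 2 - 2 * (u z * ∑ i, x i * f i z) + (∑ i, x i * f i z) ^ 2 := fun z => by ring
    simp_rw [e]
    have hus := (integrable_fun_mul_of_memLp hu hsum).const_mul 2
    rw [integral_add (f := fun z => u z ^ 2 - 2 * (u z * ∑ i, x i * f i z))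
      (Integrable.sub hu.integrable_sq hus) hsum.integrable_sq,
      integral_sub hu.integrable_sq hus, integral_const_mul, hcross, hsq]
  rw [hexp] at hnn
  change x k ≤ _
  linarith

end Information

/-! ### Schur complements -/

section Schur

variable {m n : Type*} [Fintype m] [Fintype n] [DecidableEq m] [DecidableEq n]

/-- An invertible positive semidefinite matrix is positive definite, and so is its principal block;
for a general invertible matrix the block could be singular. The rest is block inversion. -/
lemma schur_complement_of_posSemidef {F : Matrix (m ⊕ n) (m ⊕ n) ℝ} (hF : F.PosSemidef)
    (hdet : IsUnit F.det) :
    IsUnit F.toBlocks₂₂.det ∧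
      IsUnit (F.toBlocks₁₁ - F.toBlocks₁₂ * F.toBlocks₂₂⁻¹ * F.toBlocks₁₂ᵀ).det ∧
      F⁻¹.toBlocks₁₁ = (F.toBlocks₁₁ - F.toBlocks₁₂ * F.toBlocks₂₂⁻¹ * F.toBlocks₁₂ᵀ)⁻¹ := by
  have hpd : F.PosDef := hF.posDef_iff_isUnit.2 ((Matrix.isUnit_iff_isUnit_det _).2 hdet)
  have h22 : IsUnit F.toBlocks₂₂.det := by
    rw [← Matrix.isUnit_iff_isUnit_det]
    exact (hpd.submatrix Sum.inr_injective).isUnit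
  have h21 : F.toBlocks₂₁ = F.toBlocks₁₂ᵀ := by
    ext i j
    have := congrFun (congrFun hF.1 (Sum.inr i)) (Sum.inl j)
    simpa [Matrix.toBlocks₂₁, Matrix.toBlocks₁₂] using this.symm
  have hF' : F = Matrix.fromBlocks F.toBlocks₁₁ F.toBlocks₁₂ F.toBlocks₁₂ᵀ F.toBlocks₂₂ := by
    rw [← h21, Matrix.fromBlocks_toBlocks]
  let _ := Matrix.invertibleOfIsUnitDet _ h22
  have hS : IsUnit (F.toBlocks₁₁ - F.toBlocks₁₂ * ⅟F.toBlocks₂₂ * F.toBlocks₁₂ᵀ) := by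
    rw [← Matrix.isUnit_fromBlocks_iff_of_invertible₂₂, ← hF']
    exact (Matrix.isUnit_iff_isUnit_det _).2 hdet
  let _ := hS.invertible
  let _ := Matrix.fromBlocks₂₂Invertible F.toBlocks₁₁ F.toBlocks₁₂ F.toBlocks₁₂ᵀ F.toBlocks₂₂
  refine ⟨h22, ?_, ?_⟩
  · rw [← Matrix.isUnit_iff_isUnit_det, ← Matrix.invOf_eq_nonsing_inv]
    exact hS
  · have h := Matrix.invOf_fromBlocks₂₂_eq F.toBlocks₁₁ F.toBlocks₁₂ F.toBlocks₁₂ᵀ F.toBlocks₂₂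
    rw [Matrix.invOf_eq_nonsing_inv, ← hF'] at h
    rw [h, Matrix.toBlocks_fromBlocks₁₁, Matrix.invOf_eq_nonsing_inv, Matrix.invOf_eq_nonsing_inv]

end Schur

namespace IsacNetwork

variable {S K N L : ℕ} {Ω : Type*} (M : IsacNetwork S K N L Ω)

/-! ### Differentiability of the geometry -/

/-- The angle itself jumps at the branch cut of `arg`, but its sine is `Im z / ‖z‖`, which is
differentiable wherever `z ≠ 0`. The steering vector depends on the angle only through this sine. -/
lemma differentiableAt_sin_angle (s : Fin S) {p : Plane} (hp : p ≠ M.pos s) :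
    DifferentiableAt ℝ (fun q => Real.sin (M.angle s q)) p := by
  set z : Plane → ℂ := fun q => (⟨q 0 - M.pos s 0, q 1 - M.pos s 1⟩ : ℂ) *
    Complex.exp (-Complex.I * (M.boresight s : ℂ)) with hz
  have hcoord : ∀ i : Fin 2, Differentiable ℝ fun q : Plane => ((q i : ℝ) : ℂ) := fun i =>
    Complex.ofRealCLM.differentiable.comp
      (EuclideanSpace.proj i : Plane →L[ℝ] ℝ).differentiable
  have hd : DifferentiableAt ℝ z p := by
    simp only [hz, Complex.mk_eq_add_mul_I, Complex.ofReal_sub]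
    have h0 := (hcoord 0) p
    have h1 := (hcoord 1) p
    fun_prop
  have hne : z p ≠ 0 := by
    refine mul_ne_zero (fun h => hp ?_) (Complex.exp_ne_zero _)
    have h0 := congrArg Complex.re h
    have h1 := congrArg Complex.im h
    simp only [Complex.zero_re, Complex.zero_im, sub_eq_zero] at h0 h1
    ext i
    fin_cases i
    · exact h0
    · exact h1
  have : (fun q => Real.sin (M.angle s q)) = fun q => (z q).im / ‖z q‖ := by
    funext q
    exact Complex.sin_arg _
  rw [this]
  have him : DifferentiableAt ℝ (fun q => (z q).im) p :=
    Complex.imCLM.differentiableAt.comp p hd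
  simp_rw [div_eq_mul_inv]
  exact him.mul ((hd.norm ℝ hne).inv (norm_ne_zero_iff.2 hne))

lemma differentiableAt_steering (s : Fin S) {p : Plane} (hp : p ≠ M.pos s) :
    DifferentiableAt ℝ (fun q => steering N (M.angle s q)) p := by
  rw [differentiableAt_pi]
  intro n
  have h : DifferentiableAt ℝ (fun q => ((Real.sin (M.angle s q) : ℝ) : ℂ)) p :=
    Complex.ofRealCLM.differentiableAt.comp p (M.differentiableAt_sin_angle s hp)
  exact (h.const_mul _).cexp

lemma hasLineDerivAt_steering (s : Fin S) {p : Plane} (hp : p ≠ M.pos s) (i : Fin 2) :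
    HasLineDerivAt ℝ (fun q => steering N (M.angle s q)) (M.steeringDeriv s p i) p
      (EuclideanSpace.single i (1 : ℝ)) :=
  (M.differentiableAt_steering s hp).lineDifferentiableAt.hasLineDerivAt

lemma differentiableAt_response (s s' : Fin S) {p : Plane} (hp : p ≠ M.pos s)
    (hp' : p ≠ M.pos s') (a b : Fin N) :
    DifferentiableAt ℝ (fun q => M.response s s' q a b) p := by
  have h1 := differentiableAt_pi.1 (M.differentiableAt_steering (N := N) s hp) a
  have h2 := differentiableAt_pi.1 (M.differentiableAt_steering (N := N) s' hp') b
  exact h1.mul h2.star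

lemma hasLineDerivAt_response (s s' : Fin S) {p : Plane} (hp : p ≠ M.pos s)
    (hp' : p ≠ M.pos s') (i : Fin 2) (a b : Fin N) :
    HasLineDerivAt ℝ (fun q => M.response s s' q a b) (M.responseDeriv s s' p i a b) p
      (EuclideanSpace.single i (1 : ℝ)) := by
  have h1 := hasDerivAt_pi.1 (M.hasLineDerivAt_steering (N := N) s hp i) a
  have h2 := (hasDerivAt_pi.1 (M.hasLineDerivAt_steering (N := N) s' hp' i) b).star
  have h := h1.mul h2
  simp only [zero_smul, add_zero] at h
  exact h

lemma differentiableAt_delay (s s' : Fin S) {p : Plane} (hp : p ≠ M.pos s)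
    (hp' : p ≠ M.pos s') : DifferentiableAt ℝ (M.delay s s') p := by
  have h1 : DifferentiableAt ℝ (fun q : Plane => ‖q - M.pos s'‖) p :=
    (differentiableAt_id.sub_const _).norm ℝ (sub_ne_zero.2 hp')
  have h2 : DifferentiableAt ℝ (fun q : Plane => ‖q - M.pos s‖) p :=
    (differentiableAt_id.sub_const _).norm ℝ (sub_ne_zero.2 hp)
  unfold delay
  simp_rw [div_eq_mul_inv]
  exact (h1.fun_add h2).mul_const _

/-! ### Differentiability of the signals -/

/-- The signals with outcome `ω` are differentiable at the sampling instants. -/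
def SmoothSignals (s : Fin S) (p : Plane) (ω : Ω) : Prop :=
  (∀ (s' : Tx s) (k : Fin K) (l : Fin L),
    DifferentiableAt ℝ (fun t => M.sym s' k t ω) (M.instant s s' p l)) ∧
  ∀ (s' : Tx s) (n : Fin N) (l : Fin L),
    DifferentiableAt ℝ (fun t => M.sens s' t ω n) (M.instant s s' p l)

lemma transmit_apply {s : Fin S} (s' : Tx s) (ω : Ω) (t : ℝ) (n : Fin N) :
    M.transmit s s' ω t n =
      (∑ k, ((if M.assoc s' k then 1 else 0 : ℂ) * M.sym s' k t ω) * M.beam s' k n) +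
        M.sens s' t ω n := by
  simp only [transmit, select, s'.2, if_false, one_smul, Pi.add_apply, Finset.sum_apply,
    Pi.smul_apply, smul_eq_mul]

/-- Time derivative of the transmitted waveform. -/
noncomputable def transmitDeriv (s' : Fin S) (ω : Ω) (t : ℝ) (n : Fin N) : ℂ :=
  (∑ k, ((if M.assoc s' k then 1 else 0 : ℂ) * deriv (fun t => M.sym s' k t ω) t) *
    M.beam s' k n) + deriv (fun t => M.sens s' t ω n) t

lemma hasDerivAt_transmit {s : Fin S} {p : Plane} {ω : Ω} (h : M.SmoothSignals s p ω)
    (s' : Tx s) (n : Fin N) (l : Fin L) :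
    HasDerivAt (fun t => M.transmit s s' ω t n)
      (M.transmitDeriv s' ω (M.instant s s' p l) n) (M.instant s s' p l) := by
  simp_rw [M.transmit_apply]
  refine HasDerivAt.fun_add (HasDerivAt.fun_sum fun k _ => ?_) (h.2 s' n l).hasDerivAt
  exact ((h.1 s' k l).hasDerivAt.const_mul _).mul_const _

/-- Chain rule: the position enters the sampling instant only through `-τ`. -/
lemma hasFDerivAt_delayed {s : Fin S} {p : Plane} {ω : Ω} (hpos : ∀ s', p ≠ M.pos s')
    (h : M.SmoothSignals s p ω) (s' : Tx s) (n : Fin N) (l : Fin L) :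
    HasFDerivAt (fun q => M.delayed s s' ω q n l)
      ((-fderiv ℝ (M.delay s s') p).smulRight (M.transmitDeriv s' ω (M.instant s s' p l) n))
      p := by
  have h1 : HasFDerivAt (fun q => M.instant s s' q l) (-fderiv ℝ (M.delay s s') p) p :=
    (M.differentiableAt_delay s s' (hpos s) (hpos s')).hasFDerivAt.const_sub _
  refine ((M.hasDerivAt_transmit h s' n l).hasFDerivAt.comp p h1).congr_fderiv ?_
  ext v
  simp

/-- Partial derivatives of the delayed signals. -/
noncomputable def delayedDeriv (s s' : Fin S) (ω : Ω) (p : Plane) (i : Fin 2) :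
    Matrix (Fin N) (Fin L) ℂ :=
  Matrix.of fun n l => partialDeriv (fun q => M.delayed s s' ω q n l) p i

lemma delayedDeriv_apply {s : Fin S} {p : Plane} {ω : Ω} (hpos : ∀ s', p ≠ M.pos s')
    (h : M.SmoothSignals s p ω) (s' : Tx s) (i : Fin 2) (n : Fin N) (l : Fin L) :
    M.delayedDeriv s s' ω p i n l =
      -(M.delayDeriv s s' p i : ℂ) * M.transmitDeriv s' ω (M.instant s s' p l) n := by
  have h1 := M.hasFDerivAt_delayed hpos h s' n l
  have h2 := (M.differentiableAt_delay s s' (hpos s) (hpos s')).lineDeriv_eq_fderiv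
    (v := EuclideanSpace.single i (1 : ℝ))
  simp only [delayedDeriv, Matrix.of_apply, partialDeriv, delayDeriv]
  rw [h1.differentiableAt.lineDeriv_eq_fderiv, h1.fderiv, h2]
  simp

/-! ### Derivatives of the mean echo -/

/-- Partial derivatives of the mean echo in the unknowns. -/
noncomputable def meanDeriv (s : Fin S) (ξ : Param s) (ω : Ω) : Idx s → Obs N L
  | Sum.inl i => ∑ s' : Tx s, gain ξ s' • Matrix.vec
      (M.responseDeriv s s' (target ξ) i * M.delayed s s' ω (target ξ) +
        M.response s s' (target ξ) * M.delayedDeriv s s' ω (target ξ) i)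
  | Sum.inr (Sum.inl s') => Matrix.vec (M.response s s' (target ξ) * M.delayed s s' ω (target ξ))
  | Sum.inr (Sum.inr s') =>
      Complex.I • Matrix.vec (M.response s s' (target ξ) * M.delayed s s' ω (target ξ))

lemma meanEcho_apply (s : Fin S) (ξ : Param s) (ω : Ω) (m : Fin L × Fin N) :
    M.meanEcho s ξ ω m = ∑ s' : Tx s, gain ξ s' * ∑ b,
      M.response s s' (target ξ) m.2 b * M.delayed s s' ω (target ξ) b m.1 := by
  simp only [meanEcho, Finset.sum_apply, Pi.smul_apply, Matrix.vec, Matrix.mul_apply,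
    smul_eq_mul]

lemma differentiable_target (s : Fin S) : Differentiable ℝ (target : Param s → Plane) := by
  intro ξ
  rw [differentiableAt_piLp]
  intro i
  exact differentiableAt_apply (𝕜 := ℝ) _ ξ

lemma differentiable_gain {s : Fin S} (s' : Tx s) :
    Differentiable ℝ fun ξ : Param s => gain ξ s' := by
  intro ξ
  simp only [gain, Complex.mk_eq_add_mul_I]
  have h : ∀ j : Idx s, DifferentiableAt ℝ (fun ξ : Param s => ((ξ j : ℝ) : ℂ)) ξ := fun j =>
    Complex.ofRealCLM.differentiableAt.comp ξ (differentiableAt_apply (𝕜 := ℝ) j ξ)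
  exact (h _).add ((h _).mul_const _)

lemma differentiableAt_meanEcho {s : Fin S} {ξ : Param s} {ω : Ω}
    (hpos : ∀ s', target ξ ≠ M.pos s') (h : M.SmoothSignals s (target ξ) ω) :
    DifferentiableAt ℝ (fun η => M.meanEcho s η ω) ξ := by
  rw [differentiableAt_pi]
  intro m
  simp_rw [M.meanEcho_apply]
  refine DifferentiableAt.fun_sum fun s' _ => (differentiable_gain s' ξ).mul
    (DifferentiableAt.fun_sum fun b _ => ?_)
  have h1 := (M.differentiableAt_response s s' (hpos s) (hpos s') m.2 b).comp ξ
    (differentiable_target s ξ)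
  have h2 := (M.hasFDerivAt_delayed hpos h s' b m.1).differentiableAt.comp ξ
    (differentiable_target s ξ)
  exact h1.mul h2

lemma target_add_smul_inl {s : Fin S} (ξ : Param s) (i : Fin 2) (t : ℝ) :
    target (ξ + t • Pi.single (Sum.inl i) (1 : ℝ)) =
      target ξ + t • EuclideanSpace.single i (1 : ℝ) := by
  ext j
  simp [target, Pi.single_apply]

lemma target_add_smul_inr {s : Fin S} (ξ : Param s) (j : Tx s ⊕ Tx s) (t : ℝ) :
    target (ξ + t • Pi.single (Sum.inr j) (1 : ℝ)) = target ξ := by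
  ext i
  simp [target]

lemma gain_add_smul_inl {s : Fin S} (ξ : Param s) (i : Fin 2) (t : ℝ) (s' : Tx s) :
    gain (ξ + t • Pi.single (Sum.inl i) (1 : ℝ)) s' = gain ξ s' := by
  simp [gain]

lemma gain_add_smul_inr_inl {s : Fin S} (ξ : Param s) (r s' : Tx s) (t : ℝ) :
    gain (ξ + t • Pi.single (Sum.inr (Sum.inl r)) (1 : ℝ)) s' =
      gain ξ s' + t * if s' = r then 1 else 0 := by
  apply Complex.ext <;> by_cases h : s' = r <;> simp [gain, h]

lemma gain_add_smul_inr_inr {s : Fin S} (ξ : Param s) (r s' : Tx s) (t : ℝ) :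
    gain (ξ + t • Pi.single (Sum.inr (Sum.inr r)) (1 : ℝ)) s' =
      gain ξ s' + t * if s' = r then Complex.I else 0 := by
  apply Complex.ext <;> by_cases h : s' = r <;> simp [gain, h]

lemma hasDerivAt_add_ofReal_mul (a c : ℂ) : HasDerivAt (fun t : ℝ => a + t * c) c 0 := by
  simpa using ((Complex.ofRealCLM.hasDerivAt (x := (0 : ℝ))).mul_const c).const_add a

/-- Along a position coordinate the gains are constant and the product rule applies to `G X`; along
a gain coordinate the echo is affine. -/
lemma hasLineDerivAt_meanEcho {s : Fin S} {ξ : Param s} {ω : Ω}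
    (hpos : ∀ s', target ξ ≠ M.pos s') (h : M.SmoothSignals s (target ξ) ω) (i : Idx s) :
    HasLineDerivAt ℝ (fun η => M.meanEcho s η ω) (M.meanDeriv s ξ ω i) ξ
      (Pi.single i (1 : ℝ)) := by
  unfold HasLineDerivAt
  rw [hasDerivAt_pi]
  intro m
  simp_rw [M.meanEcho_apply]
  rcases i with i | r | r
  · simp_rw [target_add_smul_inl, gain_add_smul_inl]
    have hm : M.meanDeriv s ξ ω (Sum.inl i) m = ∑ s' : Tx s, gain ξ s' * ∑ b,
        (M.responseDeriv s s' (target ξ) i m.2 b * M.delayed s s' ω (target ξ) b m.1 +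
          M.response s s' (target ξ) m.2 b * M.delayedDeriv s s' ω (target ξ) i b m.1) := by
      simp only [meanDeriv, Finset.sum_apply, Pi.smul_apply, Matrix.vec, Matrix.mul_apply,
        Matrix.add_apply, smul_eq_mul, Finset.sum_add_distrib]
    rw [hm]
    refine HasDerivAt.fun_sum fun s' _ => HasDerivAt.const_mul _ (HasDerivAt.fun_sum fun b _ => ?_)
    have h1 := M.hasLineDerivAt_response s s' (hpos s) (hpos s') i m.2 b
    have h2 : HasLineDerivAt ℝ (fun q => M.delayed s s' ω q b m.1)
        (M.delayedDeriv s s' ω (target ξ) i b m.1) (target ξ) (EuclideanSpace.single i (1 : ℝ)) :=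
      (M.hasFDerivAt_delayed hpos h s' b
        m.1).differentiableAt.lineDifferentiableAt.hasLineDerivAt
    have h3 := HasDerivAt.fun_mul h1 h2
    simp only [zero_smul, add_zero] at h3
    exact h3
  · simp_rw [target_add_smul_inr, gain_add_smul_inr_inl]
    have := HasDerivAt.fun_sum (u := Finset.univ) fun (s' : Tx s) _ =>
      (hasDerivAt_add_ofReal_mul (gain ξ s') (if s' = r then 1 else 0)).mul_const (∑ b,
        M.response s s' (target ξ) m.2 b * M.delayed s s' ω (target ξ) b m.1)
    refine this.congr_deriv ?_
    simp [meanDeriv, Matrix.vec, Matrix.mul_apply]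
  · simp_rw [target_add_smul_inr, gain_add_smul_inr_inr]
    have := HasDerivAt.fun_sum (u := Finset.univ) fun (s' : Tx s) _ =>
      (hasDerivAt_add_ofReal_mul (gain ξ s') (if s' = r then Complex.I else 0)).mul_const (∑ b,
        M.response s s' (target ξ) m.2 b * M.delayed s s' ω (target ξ) b m.1)
    refine this.congr_deriv ?_
    simp [meanDeriv, Matrix.vec, Matrix.mul_apply]

/-! ### The score -/

lemma density_eq_gaussPdf (s : Fin S) (ξ : Param s) (ω : Ω) (y : Obs N L) :
    M.density s ξ ω y = gaussPdf (M.noise s) (y - M.meanEcho s ξ ω) := by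
  simp [density, gaussPdf, mul_comm N L]

lemma logLik_eq (s : Fin S) (z : Ω × Obs N L) (ξ : Param s) :
    M.logLik s z ξ = Real.log ((Real.pi * M.noise s ^ 2) ^ (N * L))⁻¹ +
      -(∑ m, ‖z.2 m - M.meanEcho s ξ z.1 m‖ ^ 2) / M.noise s ^ 2 := by
  have := M.noise_pos s
  have := Real.pi_pos
  rw [logLik, density, Real.log_mul (by positivity) (Real.exp_ne_zero _), Real.log_exp]

lemma differentiableAt_logLik {s : Fin S} {ξ : Param s} {z : Ω × Obs N L}
    (hpos : ∀ s', target ξ ≠ M.pos s') (h : M.SmoothSignals s (target ξ) z.1) :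
    DifferentiableAt ℝ (M.logLik s z) ξ := by
  have he : M.logLik s z = fun ξ => Real.log ((Real.pi * M.noise s ^ 2) ^ (N * L))⁻¹ +
      -(∑ m, ‖z.2 m - M.meanEcho s ξ z.1 m‖ ^ 2) / M.noise s ^ 2 :=
    funext fun ξ => M.logLik_eq s z ξ
  rw [he]
  have h1 : DifferentiableAt ℝ (fun η => ∑ m, ‖z.2 m - M.meanEcho s η z.1 m‖ ^ 2) ξ :=
    DifferentiableAt.fun_sum fun m _ =>
      ((differentiableAt_pi.1 (M.differentiableAt_meanEcho hpos h) m).const_sub _).norm_sq ℝ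
  simp_rw [div_eq_mul_inv]
  exact (h1.fun_neg.mul_const _).const_add _

/-- The normalising constant of the density does not involve `ξ`, so only the squared distance to
the mean is differentiated. -/
lemma score_eq {s : Fin S} {ξ : Param s} {z : Ω × Obs N L}
    (hpos : ∀ s', target ξ ≠ M.pos s') (h : M.SmoothSignals s (target ξ) z.1) (i : Idx s) :
    M.score s ξ i z = 2 / M.noise s ^ 2 *
      reInner (z.2 - M.meanEcho s ξ z.1) (M.meanDeriv s ξ z.1 i) := by
  have hmean := hasDerivAt_pi.1 (M.hasLineDerivAt_meanEcho hpos h i)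
  refine HasLineDerivAt.lineDeriv ?_
  unfold HasLineDerivAt
  simp_rw [M.logLik_eq]
  have h1 := HasDerivAt.fun_sum (u := Finset.univ) fun m _ =>
    ((hmean m).const_sub (z.2 m)).norm_sq
  refine ((h1.neg.div_const (M.noise s ^ 2)).const_add _).congr_deriv ?_
  simp only [zero_smul, add_zero, reInner, Complex.inner, Finset.mul_sum, ← Finset.sum_neg_distrib,
    Finset.sum_div]
  refine Finset.sum_congr rfl fun m _ => ?_
  simp
  ring

end IsacNetwork

namespace IsacNetwork

variable {S K N L : ℕ} {Ω : Type*} (M : IsacNetwork S K N L Ω)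

/-! ### Unbiased estimators for fixed transmitted signals -/

lemma condLaw_eq_map (s : Fin S) (ξ : Param s) (ω : Ω) :
    M.condLaw s ξ ω = (cgauss (Fin L × Fin N) (M.noise s)).map (· + M.meanEcho s ξ ω) := by
  rw [← withDensity_gaussPdf_sub, condLaw]
  simp_rw [M.density_eq_gaussPdf]

lemma target_add_smul_apply {s : Fin S} (ξ : Param s) (i : Idx s) (t : ℝ) (k : Fin 2) :
    target (ξ + t • Pi.single i (1 : ℝ)) k =
      target ξ k + t * if i = Sum.inl k then 1 else 0 := by
  simp [target, Pi.single_apply, eq_comm]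

/-- For fixed transmitted signals, a coordinate of an unbiased estimator has unit covariance with
the score in the same coordinate of the position and is uncorrelated with all the others. -/
lemma integral_estimator_mul_score {s : Fin S} {ξ : Param s} {ω : Ω}
    (hpos : ∀ s', target ξ ≠ M.pos s') (h : M.SmoothSignals s (target ξ) ω) {T : Obs N L → Plane}
    (hT : Measurable T)
    (hunb : ∀ᶠ η in 𝓝 ξ, Integrable T (M.condLaw s η ω) ∧
      ∫ y, T y ∂(M.condLaw s η ω) = target η) (k : Fin 2)
    (hL : MemLp (fun w => T (w + M.meanEcho s ξ ω) k - target ξ k) 2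
      (cgauss (Fin L × Fin N) (M.noise s))) (i : Idx s) :
    ∫ w, (T (w + M.meanEcho s ξ ω) k - target ξ k) *
        (2 / M.noise s ^ 2 * reInner w (M.meanDeriv s ξ ω i))
        ∂(cgauss (Fin L × Fin N) (M.noise s)) =
      if i = Sum.inl k then 1 else 0 := by
  have hσ := M.noise_pos s
  have := isProbabilityMeasure_cgauss (ι := Fin L × Fin N) hσ
  set γ := cgauss (Fin L × Fin N) (M.noise s)
  set μ := M.meanEcho s ξ ω with hμ
  have hTk : Measurable fun y => T y k := (EuclideanSpace.proj k : Plane →L[ℝ] ℝ).measurable.comp hT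
  have hmean := M.hasLineDerivAt_meanEcho hpos h i
  have hcurve : HasDerivAt (fun t : ℝ => M.meanEcho s (ξ + t • Pi.single i (1 : ℝ)) ω - μ)
      (M.meanDeriv s ξ ω i) 0 := HasDerivAt.sub_const _ hmean
  have hd := hasDerivAt_integral_shiftRatio hσ hL (by simp [hμ]) hcurve
  have hline : Filter.Tendsto (fun t : ℝ => ξ + t • (Pi.single i (1 : ℝ) : Param s)) (𝓝 0)
      (𝓝 ξ) := by
    have : Continuous fun t : ℝ => ξ + t • (Pi.single i (1 : ℝ) : Param s) := by fun_prop
    simpa using this.tendsto 0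
  -- The shift ratio moves the mean from `μ` to the mean echo at `ξ + t eᵢ`. There unbiasedness
  -- gives the expectation `target (ξ + t eᵢ) k`, so the error has mean `t` or `0`.
  have heq : (fun t : ℝ => ∫ w, (T (w + μ) k - target ξ k) * shiftRatio (M.noise s)
      (M.meanEcho s (ξ + t • Pi.single i (1 : ℝ)) ω - μ) w ∂γ) =ᶠ[𝓝 0]
      fun t => t * if i = Sum.inl k then 1 else 0 := by
    filter_upwards [hline.eventually hunb] with t ⟨hintegrable, hexp⟩
    have hshift : Measurable fun w : Obs N L => w + μ := measurable_id.add_const μ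
    have hf : Measurable fun w : Obs N L => T (w + μ) k - target ξ k :=
      (hTk.comp hshift).sub_const _
    rw [← integral_map_add_cgauss, integral_map (measurable_id'.add_const _).aemeasurable
      hf.aestronglyMeasurable]
    simp only [add_assoc, sub_add_cancel]
    rw [M.condLaw_eq_map] at hintegrable hexp
    have hadd : AEMeasurable (fun w : Obs N L =>
      w + M.meanEcho s (ξ + t • Pi.single i (1 : ℝ)) ω) γ :=
      (measurable_id'.add_const _).aemeasurable
    rw [integral_map hadd hT.aestronglyMeasurable] at hexp
    have hintegrable_shift : Integrable (fun w =>
        T (w + M.meanEcho s (ξ + t • Pi.single i (1 : ℝ)) ω)) γ :=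
      (integrable_map_measure hT.aestronglyMeasurable hadd).1 hintegrable
    have hk := (EuclideanSpace.proj k : Plane →L[ℝ] ℝ).integral_comp_comm hintegrable_shift
    rw [hexp] at hk
    have hintk : Integrable (fun w => T (w + M.meanEcho s (ξ + t • Pi.single i (1 : ℝ)) ω) k) γ :=
      (EuclideanSpace.proj k : Plane →L[ℝ] ℝ).integrable_comp hintegrable_shift
    rw [integral_sub hintk (integrable_const _)]
    have hk' : ∫ w, T (w + M.meanEcho s (ξ + t • Pi.single i (1 : ℝ)) ω) k ∂γ =
      target (ξ + t • Pi.single i (1 : ℝ)) k := hk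
    rw [hk', target_add_smul_apply]
    simp
  have hd' := hd.congr_of_eventuallyEq heq.symm
  refine hd'.unique ?_
  simpa using (hasDerivAt_id (0 : ℝ)).mul_const (if i = Sum.inl k then (1 : ℝ) else 0)

variable {M} [MeasurableSpace Ω] {P : Measure Ω}

/-! ### Regularity of the statistical model -/

lemma RegularSignals.ae_smoothSignals {s : Fin S} {p : Plane} (hreg : M.RegularSignals P s p) :
    ∀ᵐ ω ∂P, M.SmoothSignals s p ω := by
  have h1 : ∀ᵐ ω ∂P, ∀ (s' : Tx s) (k : Fin K) (l : Fin L),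
      DifferentiableAt ℝ (fun t => M.sym s' k t ω) (M.instant s s' p l) := by
    simpa only [ae_all_iff] using hreg.sym_diff
  have h2 : ∀ᵐ ω ∂P, ∀ (s' : Tx s) (n : Fin N) (l : Fin L),
      DifferentiableAt ℝ (fun t => M.sens s' t ω n) (M.instant s s' p l) := by
    simpa only [ae_all_iff] using hreg.sens_diff
  exact h1.and h2

lemma RegularSignals.memLp_delayed {s : Fin S} {p : Plane} (hreg : M.RegularSignals P s p)
    (s' : Tx s) (n : Fin N) (l : Fin L) :
    MemLp (fun ω => M.delayed s s' ω p n l) 2 P := by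
  simp only [delayed, Matrix.of_apply, M.transmit_apply]
  refine MemLp.add (memLp_finsetSum _ fun k _ => ?_) (hreg.sens_memLp s' n l)
  simp_rw [mul_right_comm _ _ (M.beam s' k n)]
  exact (hreg.sym_memLp s' k l).const_mul _

lemma RegularSignals.memLp_delayedDeriv {s : Fin S} {p : Plane} (hreg : M.RegularSignals P s p)
    (hpos : ∀ s', p ≠ M.pos s') (s' : Tx s) (i : Fin 2) (n : Fin N) (l : Fin L) :
    MemLp (fun ω => M.delayedDeriv s s' ω p i n l) 2 P := by
  have h : MemLp (fun ω => -(M.delayDeriv s s' p i : ℂ) *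
      M.transmitDeriv s' ω (M.instant s s' p l) n) 2 P := by
    have hk : ∀ k : Fin K, MemLp (fun ω => (if M.assoc s' k then 1 else 0 : ℂ) *
        deriv (fun t => M.sym s' k t ω) (M.instant s s' p l) * M.beam s' k n) 2 P := fun k => by
      simp_rw [mul_right_comm _ _ (M.beam s' k n)]
      exact (hreg.sym_deriv_memLp s' k l).const_mul _
    have hsum : MemLp (fun ω => M.transmitDeriv s' ω (M.instant s s' p l) n) 2 P :=
      MemLp.add (memLp_finsetSum Finset.univ fun k _ => hk k) (hreg.sens_deriv_memLp s' n l)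
    exact hsum.const_mul _
  refine h.ae_eq ?_
  filter_upwards [hreg.ae_smoothSignals] with ω hω
  exact (M.delayedDeriv_apply hpos hω s' i n l).symm

lemma memLp_matrix_mul_apply {X : Ω → Matrix (Fin N) (Fin L) ℂ}
    (hX : ∀ n l, MemLp (fun ω => X ω n l) 2 P) (A : Matrix (Fin N) (Fin N) ℂ) (n : Fin N)
    (l : Fin L) : MemLp (fun ω => (A * X ω) n l) 2 P := by
  simp only [Matrix.mul_apply]
  exact memLp_finsetSum _ fun b _ => (hX b l).const_mul _

lemma RegularSignals.memLp_meanEcho {s : Fin S} {ξ : Param s}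
    (hreg : M.RegularSignals P s (target ξ)) (m : Fin L × Fin N) :
    MemLp (fun ω => M.meanEcho s ξ ω m) 2 P := by
  simp_rw [M.meanEcho_apply]
  refine memLp_finsetSum _ fun s' _ => ?_
  have h : MemLp (fun ω => ∑ b, M.response s s' (target ξ) m.2 b *
      M.delayed s s' ω (target ξ) b m.1) 2 P :=
    memLp_finsetSum _ fun b _ => (hreg.memLp_delayed s' b m.1).const_mul _
  exact h.const_mul _

lemma RegularSignals.memLp_meanDeriv {s : Fin S} {ξ : Param s}
    (hreg : M.RegularSignals P s (target ξ)) (hpos : ∀ s', target ξ ≠ M.pos s') (i : Idx s)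
    (m : Fin L × Fin N) : MemLp (fun ω => M.meanDeriv s ξ ω i m) 2 P := by
  have h1 := fun (s' : Tx s) => memLp_matrix_mul_apply (hreg.memLp_delayed s')
  rcases i with i | r | r
  · simp only [meanDeriv, Finset.sum_apply, Pi.smul_apply, smul_eq_mul, Matrix.vec,
      Matrix.add_apply]
    exact memLp_finsetSum _ fun s' _ => ((h1 s' _ _ _).add
      (memLp_matrix_mul_apply (hreg.memLp_delayedDeriv hpos s' i) _ _ _)).const_mul _
  · exact h1 r _ _ _
  · exact (h1 r _ _ _).const_mul _

/-- The mean echo is only almost everywhere measurable in `ω`; a measurable modification leaves the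
joint law unchanged and makes the shear measurable. -/
lemma RegularSignals.exists_law_eq_map [SFinite P] {s : Fin S} {ξ : Param s}
    (hreg : M.RegularSignals P s (target ξ)) :
    ∃ μ : Ω → Obs N L, Measurable μ ∧ (∀ᵐ ω ∂P, M.meanEcho s ξ ω = μ ω) ∧
      M.law P s ξ = (P.prod (cgauss (Fin L × Fin N) (M.noise s))).map
        fun z => (z.1, z.2 + μ z.1) := by
  have hae : AEMeasurable (fun ω => M.meanEcho s ξ ω) P :=
    aemeasurable_pi_iff.2 fun m => (hreg.memLp_meanEcho m).1.aemeasurable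
  refine ⟨hae.mk _, hae.measurable_mk, hae.ae_eq_mk, ?_⟩
  rw [← withDensity_gaussPdf_prod _ hae.measurable_mk, law]
  refine withDensity_congr_ae ?_
  filter_upwards [Measure.quasiMeasurePreserving_fst.ae hae.ae_eq_mk] with z hz
  rw [M.density_eq_gaussPdf, hz]

variable (M) in
lemma quasiMeasurePreserving_fst_law [SFinite P] (s : Fin S) (ξ : Param s) :
    Measure.QuasiMeasurePreserving Prod.fst (M.law P s ξ) P :=
  Measure.quasiMeasurePreserving_fst.mono_left (withDensity_absolutelyContinuous _ _)

lemma RegularSignals.isProbabilityMeasure_law [IsProbabilityMeasure P] {s : Fin S} {ξ : Param s}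
    (hreg : M.RegularSignals P s (target ξ)) : IsProbabilityMeasure (M.law P s ξ) := by
  obtain ⟨μ, hμ, -, hlaw⟩ := hreg.exists_law_eq_map
  have := isProbabilityMeasure_cgauss (ι := Fin L × Fin N) (M.noise_pos s)
  rw [hlaw]
  exact Measure.isProbabilityMeasure_map (measurable_shear hμ).aemeasurable

lemma RegularSignals.ae_law_smoothSignals [SFinite P] {s : Fin S} {ξ : Param s}
    (hreg : M.RegularSignals P s (target ξ)) :
    ∀ᵐ z ∂(M.law P s ξ), M.SmoothSignals s (target ξ) z.1 :=
  (M.quasiMeasurePreserving_fst_law s ξ).ae hreg.ae_smoothSignals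

lemma RegularSignals.aestronglyMeasurable_score [SFinite P] {s : Fin S} {ξ : Param s}
    (hreg : M.RegularSignals P s (target ξ)) (hpos : ∀ s', target ξ ≠ M.pos s') (i : Idx s) :
    AEStronglyMeasurable (M.score s ξ i) (M.law P s ξ) := by
  have hq := M.quasiMeasurePreserving_fst_law (P := P) s ξ
  have h1 : ∀ m, AEStronglyMeasurable (fun z : Ω × Obs N L => M.meanEcho s ξ z.1 m)
      (M.law P s ξ) := fun m => (hreg.memLp_meanEcho m).1.comp_quasiMeasurePreserving hq
  have h2 : ∀ m, AEStronglyMeasurable (fun z : Ω × Obs N L => M.meanDeriv s ξ z.1 i m)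
      (M.law P s ξ) := fun m => (hreg.memLp_meanDeriv hpos i m).1.comp_quasiMeasurePreserving hq
  have h3 : ∀ m, AEStronglyMeasurable (fun z : Ω × Obs N L => z.2 m) (M.law P s ξ) := fun m =>
    ((measurable_pi_apply m).comp measurable_snd).aestronglyMeasurable
  have h4 : AEStronglyMeasurable (fun z : Ω × Obs N L => 2 / M.noise s ^ 2 *
      reInner (z.2 - M.meanEcho s ξ z.1) (M.meanDeriv s ξ z.1 i)) (M.law P s ξ) := by
    unfold reInner
    refine AEStronglyMeasurable.const_mul (Finset.aestronglyMeasurable_fun_sum _ fun m _ => ?_) _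
    exact Complex.continuous_re.comp_aestronglyMeasurable
      ((continuous_star.comp_aestronglyMeasurable ((h3 m).sub (h1 m))).mul (h2 m))
  refine h4.congr ?_
  filter_upwards [hreg.ae_law_smoothSignals] with z hz
  exact (M.score_eq hpos hz i).symm

/-- After the shear the residual `y - μ` is the noise itself, independent of the signals. -/
lemma RegularSignals.score_shear [SFinite P] {s : Fin S} {ξ : Param s}
    (hreg : M.RegularSignals P s (target ξ)) (hpos : ∀ s', target ξ ≠ M.pos s')
    {μ : Ω → Obs N L} (hμ : ∀ᵐ ω ∂P, M.meanEcho s ξ ω = μ ω) :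
    ∀ᵐ z ∂(P.prod (cgauss (Fin L × Fin N) (M.noise s))), ∀ i,
      M.score s ξ i (z.1, z.2 + μ z.1) =
        2 / M.noise s ^ 2 * reInner z.2 (M.meanDeriv s ξ z.1 i) := by
  filter_upwards [Measure.quasiMeasurePreserving_fst.ae hμ,
    Measure.quasiMeasurePreserving_fst.ae hreg.ae_smoothSignals] with z h1 h2 i
  rw [M.score_eq (z := (z.1, z.2 + μ z.1)) hpos h2 i, h1, add_sub_cancel_right]

lemma RegularSignals.memLp_score [SFinite P] {s : Fin S} {ξ : Param s}
    (hreg : M.RegularSignals P s (target ξ)) (hpos : ∀ s', target ξ ≠ M.pos s') (i : Idx s) :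
    MemLp (M.score s ξ i) 2 (M.law P s ξ) := by
  have hmeas := hreg.aestronglyMeasurable_score hpos i
  obtain ⟨μ, hμ, hae, hlaw⟩ := hreg.exists_law_eq_map
  rw [hlaw] at hmeas ⊢
  rw [memLp_map_measure_iff hmeas (measurable_shear hμ).aemeasurable]
  refine ((memLp_reInner_prod (M.noise_pos s) (hreg.memLp_meanDeriv hpos i)).const_mul
    (2 / M.noise s ^ 2)).ae_eq ?_
  filter_upwards [hreg.score_shear hpos hae] with z hz
  exact (hz i).symm

/-- The Fisher information of the Gaussian model in terms of the derivatives of the mean. -/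
lemma RegularSignals.fisher_apply [SFinite P] {s : Fin S} {ξ : Param s}
    (hreg : M.RegularSignals P s (target ξ)) (hpos : ∀ s', target ξ ≠ M.pos s') (i j : Idx s) :
    M.fisher P s ξ i j =
      2 / M.noise s ^ 2 * ∫ ω, reInner (M.meanDeriv s ξ ω i) (M.meanDeriv s ξ ω j) ∂P := by
  have hmeas := fun i => hreg.aestronglyMeasurable_score hpos i
  obtain ⟨μ, hμ, hae, hlaw⟩ := hreg.exists_law_eq_map
  simp only [fisher, Matrix.of_apply]
  rw [hlaw] at hmeas ⊢
  rw [integral_map (f := fun z => M.score s ξ i z * M.score s ξ j z)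
    (measurable_shear hμ).aemeasurable ((hmeas i).mul (hmeas j))]
  have h1 : ∫ z, M.score s ξ i (z.1, z.2 + μ z.1) * M.score s ξ j (z.1, z.2 + μ z.1)
      ∂(P.prod (cgauss (Fin L × Fin N) (M.noise s))) =
      ∫ z, (2 / M.noise s ^ 2) ^ 2 * (reInner z.2 (M.meanDeriv s ξ z.1 i) *
        reInner z.2 (M.meanDeriv s ξ z.1 j))
      ∂(P.prod (cgauss (Fin L × Fin N) (M.noise s))) := by
    refine integral_congr_ae ?_
    filter_upwards [hreg.score_shear hpos hae] with z hz
    rw [hz, hz]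
    ring
  have hσ := M.noise_pos s
  rw [h1, integral_const_mul, integral_reInner_mul_reInner_prod hσ
    (hreg.memLp_meanDeriv hpos i) (hreg.memLp_meanDeriv hpos j)]
  -- The constants combine as `(2/σ²)² · σ²/2 = 2/σ²`.
  field_simp

/-! ### The Cramér–Rao bound -/

/-- Fubini in the sheared coordinates: almost every slice of the error is square integrable, so the
identity for fixed signals applies there, and its right side does not depend on `ω`. -/
lemma IsUnbiased.integral_mul_score {s : Fin S} {ξ : Param s}
    (hreg : M.RegularSignals P s (target ξ)) (hpos : ∀ s', target ξ ≠ M.pos s')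
    [IsProbabilityMeasure P] {T : Ω × Obs N L → Plane} (hT : M.IsUnbiased P s ξ T) (k : Fin 2)
    (hL : MemLp (fun z => T z k - target ξ k) 2 (M.law P s ξ)) (i : Idx s) :
    ∫ z, (T z k - target ξ k) * M.score s ξ i z ∂(M.law P s ξ) =
      if i = Sum.inl k then 1 else 0 := by
  have hmeas := hreg.aestronglyMeasurable_score hpos i
  have hscore := hreg.memLp_score hpos i
  obtain ⟨μ, hμ, hae, hlaw⟩ := hreg.exists_law_eq_map
  have hσ := M.noise_pos s
  have := isProbabilityMeasure_cgauss (ι := Fin L × Fin N) hσ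
  have hΦ := measurable_shear hμ
  rw [hlaw] at hL hmeas hscore ⊢
  have hU : MemLp (fun z : Ω × Obs N L => T (z.1, z.2 + μ z.1) k - target ξ k) 2
      (P.prod (cgauss (Fin L × Fin N) (M.noise s))) := hL.comp_of_map hΦ.aemeasurable
  have hS : MemLp (fun z : Ω × Obs N L => M.score s ξ i (z.1, z.2 + μ z.1)) 2
      (P.prod (cgauss (Fin L × Fin N) (M.noise s))) := hscore.comp_of_map hΦ.aemeasurable
  rw [integral_map (f := fun z => (T z k - target ξ k) * M.score s ξ i z) hΦ.aemeasurable
    (hL.1.mul hmeas),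
    integral_prod _ (integrable_fun_mul_of_memLp hU hS)]
  have hslice : ∀ᵐ ω ∂P, ∫ w, (T (ω, w + μ ω) k - target ξ k) * M.score s ξ i (ω, w + μ ω)
      ∂(cgauss (Fin L × Fin N) (M.noise s)) = if i = Sum.inl k then 1 else 0 := by
    filter_upwards [hU.integrable_sq.prod_right_ae, hae, hreg.ae_smoothSignals, hT.2]
      with ω h1 h2 h3 h4
    have hTω : Measurable fun y => T (ω, y) := hT.1.comp measurable_prodMk_left
    rw [← h2]
    have hm : Measurable fun w => T (ω, w + M.meanEcho s ξ ω) k - target ξ k :=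
      (((EuclideanSpace.proj k : Plane →L[ℝ] ℝ).measurable.comp hTω).comp
        (measurable_id.add_const _)).sub_const _
    have hL2 : MemLp (fun w => T (ω, w + M.meanEcho s ξ ω) k - target ξ k) 2
        (cgauss (Fin L × Fin N) (M.noise s)) := by
      rw [memLp_two_iff_integrable_sq hm.aestronglyMeasurable]
      simpa only [← h2] using h1
    rw [← M.integral_estimator_mul_score hpos h3 hTω h4 k hL2 i]
    refine integral_congr_ae (ae_of_all _ fun w => ?_)
    simp only
    rw [M.score_eq (z := (ω, w + M.meanEcho s ξ ω)) hpos h3 i, add_sub_cancel_right]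
  refine (integral_congr_ae hslice).trans ?_
  simp

/-- The Cramér–Rao inequality for the position. -/
lemma IsUnbiased.crlb_le [IsProbabilityMeasure P] {s : Fin S} {ξ : Param s}
    (hreg : M.RegularSignals P s (target ξ)) (hpos : ∀ s', target ξ ≠ M.pos s')
    (hdet : IsUnit (M.fisher P s ξ).det) {T : Ω × Obs N L → Plane}
    (hT : M.IsUnbiased P s ξ T) :
    ENNReal.ofReal (M.crlb P s ξ) ≤ ∫⁻ z, ‖T z - target ξ‖ₑ ^ 2 ∂(M.law P s ξ) := by
  -- An infinite mean square error satisfies the bound trivially; otherwise the error is in `L²`, as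
  -- the projection argument requires.
  rcases eq_or_ne (∫⁻ z, ‖T z - target ξ‖ₑ ^ 2 ∂(M.law P s ξ)) ⊤ with htop | htop
  · rw [htop]
    exact le_top
  have hL : MemLp (fun z => T z - target ξ) 2 (M.law P s ξ) := by
    refine ⟨(hT.1.sub_const _).aestronglyMeasurable, ?_⟩
    rw [eLpNorm_lt_top_iff_lintegral_rpow_enorm_lt_top (by norm_num) (by norm_num)]
    simpa using htop.lt_top
  have hLk : ∀ k, MemLp (fun z => T z k - target ξ k) 2 (M.law P s ξ) := fun k =>
    (EuclideanSpace.proj k : Plane →L[ℝ] ℝ).comp_memLp' hL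
  have hle : M.crlb P s ξ ≤ ∫ z, ‖T z - target ξ‖ ^ 2 ∂(M.law P s ξ) := by
    have h1 : ∀ k : Fin 2, (M.fisher P s ξ)⁻¹ (Sum.inl k) (Sum.inl k) ≤
        ∫ z, (T z k - target ξ k) ^ 2 ∂(M.law P s ξ) := fun k =>
      inv_momentMatrix_apply_le (hreg.memLp_score hpos) hdet (hLk k) (Sum.inl k)
        (hT.integral_mul_score hreg hpos k (hLk k))
    have h2 : ∫ z, ‖T z - target ξ‖ ^ 2 ∂(M.law P s ξ) =
        ∑ k, ∫ z, (T z k - target ξ k) ^ 2 ∂(M.law P s ξ) := by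
      rw [← integral_finsetSum _ fun k _ => (hLk k).integrable_sq]
      refine integral_congr_ae (ae_of_all _ fun z => ?_)
      simp [EuclideanSpace.norm_sq_eq]
    rw [h2, crlb, Matrix.trace]
    exact Finset.sum_le_sum fun k _ => h1 k
  refine (ENNReal.ofReal_le_ofReal hle).trans_eq ?_
  rw [ofReal_integral_eq_lintegral_ofReal hL.norm.integrable_sq
    (ae_of_all _ fun z => sq_nonneg _)]
  refine lintegral_congr fun z => ?_
  rw [ENNReal.ofReal_pow (norm_nonneg _), ofReal_norm]

end IsacNetwork

/-! ### Cross moments of linear combinations -/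

section CrossMoment

variable {Ω : Type*} [MeasurableSpace Ω] {P : Measure Ω}

lemma integrable_mul_star_of_memLp {f g : Ω → ℂ} (hf : MemLp f 2 P) (hg : MemLp g 2 P) :
    Integrable (fun ω => f ω * star (g ω)) P :=
  hf.integrable_mul hg.star

lemma sum_integral_linearCombination_mul_star {α β l : Type*} [Fintype α] [Fintype β] [Fintype l]
    {x : α → l → Ω → ℂ} {y : β → l → Ω → ℂ} (hx : ∀ a t, MemLp (x a t) 2 P)
    (hy : ∀ b t, MemLp (y b t) 2 P) (u : α → ℂ) (v : β → ℂ) :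
    ∑ t, ∫ ω, (∑ a, u a * x a t ω) * star (∑ b, v b * y b t ω) ∂P =
      ∑ a, ∑ b, u a * star (v b) * ∑ t, ∫ ω, x a t ω * star (y b t ω) ∂P := by
  have h : ∀ t, ∫ ω, (∑ a, u a * x a t ω) * star (∑ b, v b * y b t ω) ∂P =
      ∑ a, ∑ b, u a * star (v b) * ∫ ω, x a t ω * star (y b t ω) ∂P := fun t => by
    have hintegrable : ∀ a b,
        Integrable (fun ω => u a * star (v b) * (x a t ω * star (y b t ω))) P :=
      fun a b => (integrable_mul_star_of_memLp (hx a t) (hy b t)).const_mul _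
    have he : ∀ ω, (∑ a, u a * x a t ω) * star (∑ b, v b * y b t ω) =
        ∑ a, ∑ b, u a * star (v b) * (x a t ω * star (y b t ω)) := fun ω => by
      rw [star_sum, Finset.sum_mul_sum]
      refine Finset.sum_congr rfl fun a _ => Finset.sum_congr rfl fun b _ => ?_
      rw [star_mul']
      ring
    simp_rw [he]
    rw [integral_finsetSum _ fun a _ => integrable_finsetSum _ fun b _ => hintegrable a b]
    refine Finset.sum_congr rfl fun a _ => ?_
    rw [integral_finsetSum _ fun b _ => hintegrable a b]
    simp_rw [integral_const_mul]
  simp_rw [h]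
  rw [Finset.sum_comm]
  refine Finset.sum_congr rfl fun a _ => ?_
  rw [Finset.sum_comm]
  simp_rw [Finset.mul_sum]

lemma integral_reInner_eq {l n : Type*} [Fintype l] [Fintype n] {d e : Ω → l × n → ℂ}
    (hd : ∀ m, MemLp (fun ω => d ω m) 2 P) (he : ∀ m, MemLp (fun ω => e ω m) 2 P) :
    ∫ ω, reInner (d ω) (e ω) ∂P =
      (∑ b, ∑ a, ∫ ω, e ω (a, b) * star (d ω (a, b)) ∂P).re := by
  have hintegrable : ∀ m, Integrable (fun ω => e ω m * star (d ω m)) P := fun m =>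
    integrable_mul_star_of_memLp (he m) (hd m)
  have h : ∀ ω, reInner (d ω) (e ω) = (∑ m, e ω m * star (d ω m)).re := fun ω => by
    simp only [reInner, Complex.re_sum, mul_comm]
  simp_rw [h]
  have hre := Complex.reCLM.integral_comp_comm
    (integrable_finsetSum Finset.univ fun m _ => hintegrable m)
  simp only [Complex.reCLM_apply] at hre
  rw [hre, integral_finsetSum _ fun m _ => hintegrable m, Fintype.sum_prod_type, Finset.sum_comm]

end CrossMoment

namespace IsacNetwork

variable {S K N L : ℕ} {Ω : Type*} {M : IsacNetwork S K N L Ω}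

/-! ### Linear representations of the signals and of the derivatives of the mean echo -/

variable (M) in
/-- Communication signals and components of the sensing signal of a base station. -/
noncomputable def signal (s' : Fin S) (t : ℝ) (ω : Ω) : Fin K ⊕ Fin N → ℂ
  | Sum.inl k => M.sym s' k t ω
  | Sum.inr n => M.sens s' t ω n

variable (M) in
/-- Coefficients of the transmitted waveform in the signals. -/
noncomputable def precoder (s' : Fin S) (n : Fin N) : Fin K ⊕ Fin N → ℂ
  | Sum.inl k => (if M.assoc s' k then 1 else 0 : ℂ) * M.beam s' k n
  | Sum.inr n' => if n' = n then 1 else 0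

lemma delayed_eq_sum_precoder {s : Fin S} (s' : Tx s) (ω : Ω) (p : Plane) (n : Fin N)
    (l : Fin L) : M.delayed s s' ω p n l =
      ∑ j, M.precoder s' n j * M.signal s' (M.instant s s' p l) ω j := by
  simp only [delayed, Matrix.of_apply, M.transmit_apply, Fintype.sum_sum_type, precoder, signal]
  congr 1
  · exact Finset.sum_congr rfl fun k _ => by ring
  · simp

variable (M) in
/-- Matrices `A` such that the derivatives of the mean echo are `∑_{s'} vec (A X_{s,s'})`. -/
noncomputable def coeffMatrix (s : Fin S) (ξ : Param s) (s' : Tx s) :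
    Idx s → Matrix (Fin N) (Fin N) ℂ
  | Sum.inl i => gain ξ s' • M.responseTilde s s' (target ξ) i
  | Sum.inr (Sum.inl r) => if s' = r then M.response s s' (target ξ) else 0
  | Sum.inr (Sum.inr r) => if s' = r then Complex.I • M.response s s' (target ξ) else 0

/-- The convention makes the derivative of `X` a multiple of `X`, so `Ġ X + G Ẋ` collapses to `G̃
X`, and every derivative of the mean is linear in the delayed signals with coefficients independent
of `ω`. -/
lemma meanDeriv_eq_sum_coeffMatrix {s : Fin S} {ξ : Param s} {ω : Ω}
    (hconv : ∀ (s' : Tx s) (i : Fin 2) (n : Fin N) (l : Fin L),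
      partialDeriv (fun q => M.delayed s s' ω q n l) (target ξ) i =
        -(M.delayDeriv s s' (target ξ) i : ℂ) * M.delayed s s' ω (target ξ) n l)
    (i : Idx s) (l : Fin L) (n : Fin N) :
    M.meanDeriv s ξ ω i (l, n) = ∑ a : Tx s × Fin N,
      M.coeffMatrix s ξ a.1 i n a.2 * M.delayed s a.1 ω (target ξ) a.2 l := by
  rw [Fintype.sum_prod_type]
  rcases i with i | r | r
  · have hX : ∀ s' : Tx s, M.delayedDeriv s s' ω (target ξ) i =
        -(M.delayDeriv s s' (target ξ) i : ℂ) • M.delayed s s' ω (target ξ) := fun s' => by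
      ext n l
      exact hconv s' i n l
    simp only [meanDeriv, Finset.sum_apply, hX]
    refine Finset.sum_congr rfl fun s' _ => ?_
    have : M.responseDeriv s s' (target ξ) i * M.delayed s s' ω (target ξ) +
        M.response s s' (target ξ) * (-(M.delayDeriv s s' (target ξ) i : ℂ) •
          M.delayed s s' ω (target ξ)) =
        M.responseTilde s s' (target ξ) i * M.delayed s s' ω (target ξ) := by
      rw [responseTilde, Matrix.sub_mul, Matrix.smul_mul, Matrix.mul_smul, neg_smul,
        sub_eq_add_neg]
    rw [this]
    simp only [Pi.smul_apply, Matrix.vec, Matrix.mul_apply, coeffMatrix, Matrix.smul_apply,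
      smul_eq_mul, Finset.mul_sum, mul_assoc]
  · rw [Finset.sum_eq_single r]
    · simp [meanDeriv, Matrix.vec, Matrix.mul_apply, coeffMatrix]
    · intro b _ hb
      simp [coeffMatrix, hb]
    · simp
  · rw [Finset.sum_eq_single r]
    · simp [meanDeriv, Matrix.vec, Matrix.mul_apply, coeffMatrix, Finset.mul_sum, mul_assoc]
    · intro b _ hb
      simp [coeffMatrix, hb]
    · simp

variable [MeasurableSpace Ω] {P : Measure Ω}

/-! ### Second moments of the delayed signals -/

lemma RegularSignals.memLp_signal {s : Fin S} {p : Plane} (hreg : M.RegularSignals P s p)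
    (s' : Tx s) (j : Fin K ⊕ Fin N) (l : Fin L) :
    MemLp (fun ω => M.signal s' (M.instant s s' p l) ω j) 2 P := by
  rcases j with k | n
  · exact hreg.sym_memLp s' k l
  · exact hreg.sens_memLp s' n l

variable (M P) in
/-- Covariance of the signals of a base station. -/
noncomputable def signalCov (s' : Fin S) : Fin K ⊕ Fin N → Fin K ⊕ Fin N → ℂ
  | Sum.inl k, Sum.inl k' => if k = k' then 1 else 0
  | Sum.inl _, Sum.inr _ => 0
  | Sum.inr _, Sum.inl _ => 0
  | Sum.inr m, Sum.inr n => M.sensCov P s' m n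

lemma eq_natCast_mul_of_inv_mul_sum_eq {f : Fin L → ℂ} {c : ℂ}
    (h : (L : ℂ)⁻¹ * ∑ l, f l = c) : ∑ l, f l = L * c := by
  -- For `L = 0` the inverse is the default value `0`, but the empty sum and `0 * c` still agree.
  rcases eq_or_ne L 0 with rfl | hL
  · simp
  · rw [← h, mul_inv_cancel_left₀ (Nat.cast_ne_zero.2 hL)]

lemma SignalStatistics.sum_integral_signal {s : Fin S} {p : Plane}
    (hst : M.SignalStatistics P s p) (s₁ s₂ : Tx s) (j₁ j₂ : Fin K ⊕ Fin N) :
    ∑ l : Fin L, ∫ ω, M.signal s₁ (M.instant s s₁ p l) ω j₁ *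
        star (M.signal s₂ (M.instant s s₂ p l) ω j₂) ∂P =
      L * if s₁ = s₂ then M.signalCov P s₁ j₁ j₂ else 0 := by
  rcases j₁ with k₁ | n₁ <;> rcases j₂ with k₂ | n₂
  · refine (eq_natCast_mul_of_inv_mul_sum_eq (hst.sym_sym s₁ s₂ k₁ k₂)).trans ?_
    simp only [signalCov, ite_and]
  · refine (eq_natCast_mul_of_inv_mul_sum_eq (hst.sym_sens s₁ s₂ k₁ n₂)).trans ?_
    simp [signalCov]
  -- This order of sensing and communication signal is the complex conjugate of the assumed one.
  · have h := congrArg star (eq_natCast_mul_of_inv_mul_sum_eq (hst.sym_sens s₂ s₁ k₂ n₁))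
    simp only [star_sum, mul_zero, star_zero] at h
    simp only [signalCov, ite_self, mul_zero]
    rw [← h]
    refine Finset.sum_congr rfl fun l _ => ?_
    rw [Complex.star_def, ← integral_conj]
    refine integral_congr_ae (ae_of_all _ fun ω => ?_)
    simp [signal, mul_comm]
  · exact eq_natCast_mul_of_inv_mul_sum_eq (hst.sens_sens s₁ s₂ n₁ n₂)

/-- With `B` the precoder and `Σ` the signal covariance this is `B Σ Bᴴ = Q`: the identity block of
`Σ` yields the beamforming terms and the sensing block yields `R`. -/
lemma sum_precoder_signalCov (s' : Fin S) (m n : Fin N) :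
    ∑ j₁, ∑ j₂, M.precoder s' m j₁ * star (M.precoder s' n j₂) * M.signalCov P s' j₁ j₂ =
      M.txCov P s' m n := by
  simp only [Fintype.sum_sum_type, precoder, signalCov, txCov, Matrix.add_apply,
    Matrix.sum_apply, Matrix.smul_apply, vecMulVec_apply, mul_zero, Finset.sum_const_zero,
    add_zero, zero_add]
  congr 1
  · refine Finset.sum_congr rfl fun k _ => ?_
    rw [Finset.sum_eq_single k]
    · by_cases h : M.assoc s' k <;> simp [h]
    · intro b _ hb
      simp [hb.symm]
    · simp
  · simp

lemma SignalStatistics.sum_integral_delayed {s : Fin S} {p : Plane}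
    (hst : M.SignalStatistics P s p) (hreg : M.RegularSignals P s p) (s₁ s₂ : Tx s)
    (m n : Fin N) :
    ∑ l : Fin L, ∫ ω, M.delayed s s₁ ω p m l * star (M.delayed s s₂ ω p n l) ∂P =
      if s₁ = s₂ then (L : ℂ) * M.txCov P s₁ m n else 0 := by
  simp_rw [delayed_eq_sum_precoder]
  rw [sum_integral_linearCombination_mul_star
    (x := fun j l ω => M.signal s₁ (M.instant s s₁ p l) ω j)
    (y := fun j l ω => M.signal s₂ (M.instant s s₂ p l) ω j)
    (hreg.memLp_signal s₁) (hreg.memLp_signal s₂)]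
  simp_rw [hst.sum_integral_signal]
  split_ifs with h
  · subst h
    rw [← sum_precoder_signalCov, Finset.mul_sum]
    refine Finset.sum_congr rfl fun j₁ _ => ?_
    rw [Finset.mul_sum]
    exact Finset.sum_congr rfl fun j₂ _ => by ring
  · simp

/-! ### The blocks of the Fisher information matrix -/

lemma trace_mul_mul_conjTranspose_eq (A Q B : Matrix (Fin N) (Fin N) ℂ) :
    (A * Q * Bᴴ).trace = ∑ n, ∑ b₁, ∑ b₂, A n b₁ * star (B n b₂) * Q b₁ b₂ := by
  simp only [Matrix.trace, Matrix.diag_apply, Matrix.mul_apply, Matrix.conjTranspose_apply,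
    Finset.sum_mul]
  refine Finset.sum_congr rfl fun n _ => ?_
  rw [Finset.sum_comm]
  exact Finset.sum_congr rfl fun b₁ _ => Finset.sum_congr rfl fun b₂ _ => by ring

/-- One formula covers all blocks. Summing over slots before the antennas brings in the averaged
statistics, which remove the cross terms between different stations and produce the factor `L`. -/
lemma fisher_apply_eq_trace [SFinite P] {s : Fin S} {ξ : Param s}
    (hreg : M.RegularSignals P s (target ξ)) (hpos : ∀ s', target ξ ≠ M.pos s')
    (hconv : M.DelayConvention P s (target ξ)) (hst : M.SignalStatistics P s (target ξ))
    (i j : Idx s) :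
    M.fisher P s ξ i j = M.snrFactor s *
      (∑ s' : Tx s, (M.coeffMatrix s ξ s' j * M.txCov P s' *
        (M.coeffMatrix s ξ s' i)ᴴ).trace).re := by
  rw [hreg.fisher_apply hpos, integral_reInner_eq (hreg.memLp_meanDeriv hpos i)
    (hreg.memLp_meanDeriv hpos j)]
  have h1 : ∀ n : Fin N, ∑ l : Fin L, ∫ ω, M.meanDeriv s ξ ω j (l, n) *
      star (M.meanDeriv s ξ ω i (l, n)) ∂P =
      ∑ l : Fin L, ∫ ω, (∑ a : Tx s × Fin N,
        M.coeffMatrix s ξ a.1 j n a.2 * M.delayed s a.1 ω (target ξ) a.2 l) *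
        star (∑ a : Tx s × Fin N,
        M.coeffMatrix s ξ a.1 i n a.2 * M.delayed s a.1 ω (target ξ) a.2 l) ∂P := fun n => by
    refine Finset.sum_congr rfl fun l _ => integral_congr_ae ?_
    filter_upwards [hconv] with ω hω
    rw [meanDeriv_eq_sum_coeffMatrix hω, meanDeriv_eq_sum_coeffMatrix hω]
  have h2 : ∀ n : Fin N, ∑ l : Fin L, ∫ ω, M.meanDeriv s ξ ω j (l, n) *
      star (M.meanDeriv s ξ ω i (l, n)) ∂P =
      L * ∑ s' : Tx s, ∑ b₁, ∑ b₂, M.coeffMatrix s ξ s' j n b₁ *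
        star (M.coeffMatrix s ξ s' i n b₂) * M.txCov P s' b₁ b₂ := fun n => by
    rw [h1, sum_integral_linearCombination_mul_star
      (x := fun (a : Tx s × Fin N) l ω => M.delayed s a.1 ω (target ξ) a.2 l)
      (y := fun (a : Tx s × Fin N) l ω => M.delayed s a.1 ω (target ξ) a.2 l)
      (fun a l => hreg.memLp_delayed a.1 a.2 l) (fun a l => hreg.memLp_delayed a.1 a.2 l)]
    simp_rw [hst.sum_integral_delayed hreg, Fintype.sum_prod_type, Finset.mul_sum]
    refine Finset.sum_congr rfl fun s₁ _ => Finset.sum_congr rfl fun b₁ _ => ?_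
    rw [Finset.sum_eq_single s₁]
    · simp only [if_true]
      exact Finset.sum_congr rfl fun b₂ _ => by ring
    · intro s₂ _ hne
      simp [hne.symm]
    · simp
  simp_rw [h2, trace_mul_mul_conjTranspose_eq]
  rw [← Finset.mul_sum, Finset.sum_comm, snrFactor]
  have hre : ∀ z : ℂ, ((L : ℂ) * z).re = L * z.re := fun z => by simp
  rw [hre]
  ring

lemma sensCov_conjTranspose (s' : Fin S) : (M.sensCov P s')ᴴ = M.sensCov P s' := by
  ext m n
  simp only [Matrix.conjTranspose_apply, sensCov, Matrix.of_apply, star_mul', star_sum]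
  congr 1
  · simp
  · refine Finset.sum_congr rfl fun l _ => ?_
    rw [Complex.star_def, ← integral_conj]
    refine integral_congr_ae (ae_of_all _ fun ω => ?_)
    simp [mul_comm]

lemma txCov_conjTranspose (s' : Fin S) : (M.txCov P s')ᴴ = M.txCov P s' := by
  rw [txCov, Matrix.conjTranspose_add, sensCov_conjTranspose, Matrix.conjTranspose_sum]
  congr 1
  refine Finset.sum_congr rfl fun k _ => ?_
  ext m n
  by_cases h : M.assoc s' k <;> simp [h, vecMulVec_apply, mul_comm]

/-- The matrix `G Q Gᴴ` is Hermitian because `Q` is. A real trace makes the information between real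
and imaginary parts of the gains vanish, since there it is multiplied by `±i` before taking real
parts. -/
lemma im_trace_response (s s' : Fin S) (p : Plane) :
    (M.response s s' p * M.txCov P s' * (M.response s s' p)ᴴ).trace.im = 0 := by
  rw [← Complex.conj_eq_iff_im, ← Complex.star_def, ← Matrix.trace_conjTranspose,
    Matrix.conjTranspose_mul, Matrix.conjTranspose_mul, Matrix.conjTranspose_conjTranspose,
    txCov_conjTranspose, Matrix.mul_assoc]

lemma fisher_eq_fromBlocks [SFinite P] {s : Fin S} {ξ : Param s}
    (hreg : M.RegularSignals P s (target ξ)) (hpos : ∀ s', target ξ ≠ M.pos s')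
    (hconv : M.DelayConvention P s (target ξ)) (hst : M.SignalStatistics P s (target ξ)) :
    M.fisher P s ξ = Matrix.fromBlocks (M.Fpp P s ξ) (M.Fpa P s ξ) (M.Fpa P s ξ)ᵀ
      (M.Faa P s ξ) := by
  have key := fisher_apply_eq_trace hreg hpos hconv hst
  have hpa : ∀ i j, M.fisher P s ξ (Sum.inl i) (Sum.inr j) = M.Fpa P s ξ i j := by
    rintro i (r | r)
    · rw [key, Finset.sum_eq_single r]
      · simp [coeffMatrix, Fpa, Dmat]
      · intro b _ hb
        simp [coeffMatrix, hb]
      · simp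
    · rw [key, Finset.sum_eq_single r]
      · simp [coeffMatrix, Fpa, Dmat, mul_left_comm]
      · intro b _ hb
        simp [coeffMatrix, hb]
      · simp
  -- The Fisher matrix is by definition a moment matrix, so the lower left block needs no
  -- computation of its own.
  have hsymm : ∀ i j, M.fisher P s ξ i j = M.fisher P s ξ j i := fun i j =>
    congrFun (congrFun (momentMatrix_transpose (Q := M.law P s ξ) (M.score s ξ)) j) i
  have haa : ∀ r r' : Tx s, (∑ s' : Tx s, ((if s' = r' then M.response s s' (target ξ) else 0) *
      M.txCov P s' * (if s' = r then M.response s s' (target ξ) else 0)ᴴ).trace) =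
      if r = r' then (M.response s r (target ξ) * M.txCov P r *
        (M.response s r (target ξ))ᴴ).trace else 0 := fun r r' => by
    rw [Finset.sum_eq_single r]
    · by_cases h : r = r' <;> simp [h]
    · intro b _ hb
      simp [hb]
    · simp
  -- Pulling `i` out of the case distinction lets `haa` serve all four gain blocks, with factors
  -- `1`, `i`, `-i` and `i · (-i) = 1`.
  have hI : ∀ s' r : Tx s, (if s' = r then Complex.I • M.response s s' (target ξ) else 0) =
      Complex.I • (if s' = r then M.response s s' (target ξ) else 0) := fun s' r => by
    split_ifs <;> simp
  ext i j
  rcases i with i | i <;> rcases j with j | j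
  · rw [key, Matrix.fromBlocks_apply₁₁]
    simp only [Fpp, Matrix.smul_apply, Matrix.of_apply, smul_eq_mul, Matrix.trace_sum]
    congr 2
    refine Finset.sum_congr rfl fun s' _ => ?_
    simp only [coeffMatrix, Matrix.smul_mul, Matrix.mul_smul, Matrix.conjTranspose_smul,
      Matrix.trace_smul, smul_eq_mul]
    rw [← mul_assoc, Complex.star_def, Complex.conj_mul', Complex.ofReal_pow]
  · rw [hpa, Matrix.fromBlocks_apply₁₂]
  · rw [hsymm, hpa, Matrix.fromBlocks_apply₂₁, Matrix.transpose_apply]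
  · rw [key, Matrix.fromBlocks_apply₂₂]
    have him := fun r : Tx s => im_trace_response (M := M) (P := P) s r (target ξ)
    rcases i with r | r <;> rcases j with r' | r' <;>
      simp only [coeffMatrix, hI, Matrix.smul_mul, Matrix.mul_smul, Matrix.conjTranspose_smul,
        Matrix.trace_smul, smul_eq_mul, ← Finset.mul_sum, haa] <;>
      by_cases h : r = r' <;>
      simp [Faa, Emat, h, him]

end IsacNetwork

/-! ### Assembly: regularity, Schur complement with the bound, and explicit blocks -/

theorem proposition1 {S K N L : ℕ} {Ω : Type*} [MeasurableSpace Ω]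
    (P : Measure Ω) [IsProbabilityMeasure P]
    (M : IsacNetwork S K N L Ω) (s : Fin S) (ξ : IsacNetwork.Param s)
    (hpos : ∀ s', IsacNetwork.target ξ ≠ M.pos s')
    (hreg : M.RegularSignals P s (IsacNetwork.target ξ)) :
    -- the statistical model is regular at `ξ`
    (IsProbabilityMeasure (M.law P s ξ) ∧
      (∀ᵐ z ∂(M.law P s ξ), DifferentiableAt ℝ (M.logLik s z) ξ) ∧
      (∀ i, MemLp (M.score s ξ i) 2 (M.law P s ξ))) ∧
    -- the bound as a Schur complement, and its validity for unbiased estimators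
    (IsUnit (M.fisher P s ξ).det →
      IsUnit (M.fisher P s ξ).toBlocks₂₂.det ∧
      IsUnit ((M.fisher P s ξ).toBlocks₁₁ - (M.fisher P s ξ).toBlocks₁₂ *
        (M.fisher P s ξ).toBlocks₂₂⁻¹ * (M.fisher P s ξ).toBlocks₁₂ᵀ).det ∧
      M.crlb P s ξ = Matrix.trace ((M.fisher P s ξ).toBlocks₁₁ -
        (M.fisher P s ξ).toBlocks₁₂ * (M.fisher P s ξ).toBlocks₂₂⁻¹ *
          (M.fisher P s ξ).toBlocks₁₂ᵀ)⁻¹ ∧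
      ∀ T : Ω × IsacNetwork.Obs N L → Plane, M.IsUnbiased P s ξ T →
        ENNReal.ofReal (M.crlb P s ξ) ≤
          ∫⁻ z, ‖T z - IsacNetwork.target ξ‖ₑ ^ 2 ∂(M.law P s ξ)) ∧
    -- the explicit blocks of the Fisher information matrix
    (M.DelayConvention P s (IsacNetwork.target ξ) →
      M.SignalStatistics P s (IsacNetwork.target ξ) →
      M.fisher P s ξ = Matrix.fromBlocks (M.Fpp P s ξ) (M.Fpa P s ξ)
        (M.Fpa P s ξ)ᵀ (M.Faa P s ξ) ∧
      (IsUnit (M.fisher P s ξ).det →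
        M.crlb P s ξ = Matrix.trace
          (M.Fpp P s ξ - M.Fpa P s ξ * (M.Faa P s ξ)⁻¹ * (M.Fpa P s ξ)ᵀ)⁻¹)) := by
  have hpsd : (M.fisher P s ξ).PosSemidef := posSemidef_momentMatrix (hreg.memLp_score hpos)
  refine ⟨⟨hreg.isProbabilityMeasure_law, ?_, hreg.memLp_score hpos⟩, fun hdet => ?_,
    fun hconv hst => ?_⟩
  · filter_upwards [hreg.ae_law_smoothSignals] with z hz
    exact M.differentiableAt_logLik hpos hz
  · obtain ⟨h1, h2, h3⟩ := schur_complement_of_posSemidef hpsd hdet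
    exact ⟨h1, h2, by rw [IsacNetwork.crlb, h3], fun T hT => hT.crlb_le hreg hpos hdet⟩
  · have hF := IsacNetwork.fisher_eq_fromBlocks hreg hpos hconv hst
    refine ⟨hF, fun hdet => ?_⟩
    obtain ⟨-, -, h3⟩ := schur_complement_of_posSemidef hpsd hdet
    rw [IsacNetwork.crlb, h3, hF, Matrix.toBlocks_fromBlocks₁₁, Matrix.toBlocks_fromBlocks₁₂,
      Matrix.toBlocks_fromBlocks₂₂]
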